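/- Let $(N,\langle\cdot,\cdot\rangle)$ be a smooth, time-oriented four-dimensional Lorentzian manifold of signature $(-,+,+,+)$, let $\Sigma$ be a closed (compact, without boundary) smooth 2-manifold, and let $\Phi:\Sigma\to N$ be a smooth embedding with spacelike image; identify $\Sigma$ with $\Phi(\Sigma)$. The normal bundle $T^\perp\Sigma$ then carries an induced metric of signature $(-,+)$, so that the spacelike vectors of each fiber form two opposite quadrants. Assume that an outward direction of $\Sigma$ is given, i.e. a continuous choice of one of these two quadrants in each fiber (as given by a smooth spacelike normal field), whose elements are called outward-spacelike. Let $w\mapsto w^\perp$ be the involution of $T^\perp\Sigma$ that, in each fiber, is the linear map exchanging $u$ and $v$ for an orthonormal basis $(u,v)$ with $u$ future-timelike and $v$ outward-spacelike. Let $\nabla^\perp$ be the connection on $T^\perp\Sigma$ obtained by projecting the Levi-Civita connection of $N$ orthogonally onto $T^\perp\Sigma$. For a smooth, unit-length, outward-spacelike section $\nu$ of $T^\perp\Sigma$ let $\alpha_\nu$ be its connection 1-form, $$\alpha_\nu(X)=\langle\nabla^\perp_X\nu,\nu^\perp\rangle\qquad (X\in T\Sigma),$$ and put $$\mathcal C(\nu)=\int_\Sigma|\alpha_\nu|^2\,dA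 ,$$ where the norm $|\cdot|$, the area measure $dA$ and the divergence $\operatorname{div}_\Sigma$ are those of the Riemannian metric induced on $\Sigma$. **Proposition.** Let $\nu$ be a smooth, unit-length, outward-spacelike section of $T^\perp\Sigma$. Then $\nu$ minimizes $\mathcal C$ among all smooth, unit-length, outward-spacelike sections of $T^\perp\Sigma$ if and only if $\operatorname{div}_\Sigma(\alpha_\nu)=0$ on $\Sigma$. -/

import Mathlib

open Set MeasureTheory Bundle
open scoped Manifold ContDiff

noncomputable section

namespace StraightOut

/-- The coordinate space `ℝⁿ` with its Euclidean structure. -/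
abbrev Coord (n : ℕ) : Type := EuclideanSpace ℝ (Fin n)

/-! ### Tensor fields in the coordinates of a chart -/

section Charts

variable {n : ℕ} {M : Type*} [TopologicalSpace M] [ChartedSpace (Coord n) M]

/-- Fields of bilinear forms on the tangent spaces of `M`. -/
abbrev BilinField (n : ℕ) (M : Type*) [TopologicalSpace M] [ChartedSpace (Coord n) M] : Type _ :=
  ∀ x : M, TangentSpace (𝓡 n) x →L[ℝ] TangentSpace (𝓡 n) x →L[ℝ] ℝ

/-- 1-forms on `M`. -/
abbrev OneForm (n : ℕ) (M : Type*) [TopologicalSpace M] [ChartedSpace (Coord n) M] : Type _ :=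
  ∀ x : M, TangentSpace (𝓡 n) x →L[ℝ] ℝ

variable [IsManifold (𝓡 n) ∞ M]

/-- The coordinate frame, at `x`, of the preferred chart around `x₀`: it sends `c ∈ ℝⁿ` to the
tangent vector `∑ cⁱ ∂ᵢ` at `x`. (The trivialization of the tangent bundle attached to `x₀` is the
derivative of that chart.) -/
def frame (x₀ x : M) : Coord n →L[ℝ] TangentSpace (𝓡 n) x :=
  (trivializationAt (Coord n) (TangentSpace (𝓡 n)) x₀).symmL ℝ x

/-- The components of a tangent vector at `x` in the preferred chart around `x₀`. -/
def comps (x₀ x : M) : TangentSpace (𝓡 n) x →L[ℝ] Coord n :=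
  (trivializationAt (Coord n) (TangentSpace (𝓡 n)) x₀).continuousLinearMapAt ℝ x

/-- The components `b_{ij}(y)` of a field of bilinear forms in the preferred chart `φ` around `x₀`,
as a function of `y = φ(x)`, bundled as a bilinear form on `ℝⁿ`. -/
def bilinCoord (b : BilinField n M) (x₀ : M) (y : Coord n) : Coord n →L[ℝ] Coord n →L[ℝ] ℝ :=
  let x := (extChartAt (𝓡 n) x₀).symm y
  (ContinuousLinearMap.precomp ℝ (frame x₀ x)) ∘L (b x) ∘L (frame x₀ x)

/-- The components of a 1-form in the preferred chart `φ` around `x₀`, as a function of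
`y = φ(x)`. -/
def formCoord (a : OneForm n M) (x₀ : M) (y : Coord n) : Coord n →L[ℝ] ℝ :=
  let x := (extChartAt (𝓡 n) x₀).symm y
  (a x) ∘L (frame x₀ x)

/-! ### The Levi-Civita connection -/

set_option synthInstance.maxHeartbeats 200000 in
/-- The Christoffel symbols of the first kind of the metric `b`, at `x₀`, in the preferred chart
around `x₀`:
`christoffelLower b x₀ v u w = ½ (∂_u b(v, w) + ∂_v b(u, w) - ∂_w b(v, u))`. -/
def christoffelLower (b : BilinField n M) (x₀ : M) (v : Coord n) :
    Coord n →L[ℝ] Coord n →L[ℝ] ℝ :=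
  let D : Coord n →L[ℝ] Coord n →L[ℝ] Coord n →L[ℝ] ℝ :=
    fderiv ℝ (bilinCoord b x₀) (extChartAt (𝓡 n) x₀ x₀)
  (1 / 2 : ℝ) • (D.flip v + D v - (D.flip v).flip)

/-- The Christoffel symbols (of the second kind) of the Levi-Civita connection of the nondegenerate
metric `b`, at `x₀`, in the preferred chart around `x₀`: `christoffel b x₀ v u` has the components
`Γᵏᵢⱼ uⁱ vʲ`. -/
def christoffel (b : BilinField n M) (x₀ : M) (v : Coord n) : Coord n →L[ℝ] Coord n :=
  (bilinCoord b x₀ (extChartAt (𝓡 n) x₀ x₀)).inverse ∘L christoffelLower b x₀ v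

/-! ### Riemannian surfaces: area, sharp, norm and divergence of 1-forms -/

/-- The vector field dual to the 1-form `a` with respect to the metric `h`. -/
def sharp (h : BilinField n M) (a : OneForm n M) (x : M) : TangentSpace (𝓡 n) x :=
  (h x).inverse (a x)

/-- The pointwise squared norm `|a|² = hⁱʲ aᵢ aⱼ` of a 1-form with respect to the metric `h`. -/
def normSq (h : BilinField n M) (a : OneForm n M) (x : M) : ℝ :=
  a x (sharp h a x)

/-- The density `√(det hᵢⱼ)` of `h` in the preferred chart around `x₀`. -/
def density (h : BilinField n M) (x₀ : M) (y : Coord n) : ℝ :=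
  √ (Matrix.det (Matrix.of fun i j : Fin n =>
    bilinCoord h x₀ y (EuclideanSpace.single i 1) (EuclideanSpace.single j 1)))

/-- The Riemannian measure `√(det hᵢⱼ) dy¹ ⋯ dyⁿ` on the domain of the preferred chart around `x₀`,
extended by zero to `M`. -/
def chartArea [MeasurableSpace M] (h : BilinField n M) (x₀ : M) : Measure M :=
  Measure.map (extChartAt (𝓡 n) x₀).symm
    ((volume.restrict (extChartAt (𝓡 n) x₀).target).withDensity
      (fun y => ENNReal.ofReal (density h x₀ y)))

/-- The Riemannian measure `dA` of `h`. The measures on the chart domains agree on overlaps, so that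
their supremum in the lattice of measures is the measure on `M` that restricts to each of them. -/
def area [MeasurableSpace M] (h : BilinField n M) : Measure M :=
  ⨆ x₀ : M, chartArea h x₀

/-- The divergence of a 1-form `a` with respect to the metric `h`, i.e. the divergence of the dual
vector field, computed at `x` in the preferred chart around `x`:
`div a = (√det h)⁻¹ ∂ᵢ(√det h · hⁱʲ aⱼ)`. -/
def divergence (h : BilinField n M) (a : OneForm n M) (x : M) : ℝ :=
  let y₀ := extChartAt (𝓡 n) x x
  (density h x y₀)⁻¹ * ∑ i : Fin n,
    (fderiv ℝ (fun y => density h x y • (bilinCoord h x y).inverse (formCoord a x y)) y₀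
      (EuclideanSpace.single i 1)) i

end Charts

/-! ### Spacetimes -/

/-- A smooth Lorentzian metric, of signature `(-,+,+,+)`, on a 4-manifold. -/
structure LorentzMetric (N : Type*) [TopologicalSpace N] [ChartedSpace (Coord 4) N]
    [IsManifold (𝓡 4) ∞ N] where
  /-- The scalar product on each tangent space. -/
  val : BilinField 4 N
  symm : ∀ (x : N) (v w : TangentSpace (𝓡 4) x), val x v w = val x w v
  signature : ∀ x : N, ∃ e : Module.Basis (Fin 4) ℝ (TangentSpace (𝓡 4) x),
    ∀ i j, val x (e i) (e j) = if i = j then (if i = 0 then -1 else 1) else 0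
  smooth : ContMDiff (𝓡 4) ((𝓡 4).prod 𝓘(ℝ, Coord 4 →L[ℝ] Coord 4 →L[ℝ] ℝ)) ∞
    (fun x => TotalSpace.mk' (Coord 4 →L[ℝ] Coord 4 →L[ℝ] ℝ) x (val x))

section Spacetime

variable {N : Type*} [TopologicalSpace N] [ChartedSpace (Coord 4) N] [IsManifold (𝓡 4) ∞ N]

/-- A time orientation, given by a smooth timelike vector field: the future-timelike vectors are the
timelike ones in the same cone. -/
structure TimeOrientation (g : LorentzMetric N) where
  /-- The reference field. -/
  field : ∀ x : N, TangentSpace (𝓡 4) x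
  smooth : ContMDiff (𝓡 4) (𝓡 4).tangent ∞
    (fun x => (⟨x, field x⟩ : TangentBundle (𝓡 4) N))
  timelike : ∀ x, g.val x (field x) (field x) < 0

/-- `w` is future-timelike: it is timelike and in the same cone as the reference field. -/
def TimeOrientation.IsFuture {g : LorentzMetric N} (T : TimeOrientation g) (x : N)
    (w : TangentSpace (𝓡 4) x) : Prop :=
  g.val x w w < 0 ∧ g.val x w (T.field x) < 0

/-! ### Spacelike surfaces and their normal bundles -/

variable {S : Type*} [TopologicalSpace S] [ChartedSpace (Coord 2) S] [IsManifold (𝓡 2) ∞ S]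

/-- Vector fields of `N` along `Φ : S → N`. -/
abbrev FieldAlong (Φ : S → N) : Type _ := ∀ p : S, TangentSpace (𝓡 4) (Φ p)

/-- Smoothness of a vector field along `Φ`. -/
def FieldAlong.Smooth {Φ : S → N} (V : FieldAlong Φ) : Prop :=
  ContMDiff (𝓡 2) (𝓡 4).tangent ∞ (fun p => (⟨Φ p, V p⟩ : TangentBundle (𝓡 4) N))

/-- The differential of `Φ`. -/
def differential (Φ : S → N) (p : S) : TangentSpace (𝓡 2) p →L[ℝ] TangentSpace (𝓡 4) (Φ p) :=
  mfderiv (𝓡 2) (𝓡 4) Φ p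

/-- The metric induced on `S` by `Φ`. -/
def induced (g : LorentzMetric N) (Φ : S → N) : BilinField 2 S := fun p =>
  (ContinuousLinearMap.precomp ℝ (differential Φ p)) ∘L (g.val (Φ p)) ∘L (differential Φ p)

/-- `Φ` is a smooth embedding with spacelike image: the induced metric is Riemannian. -/
structure IsSpacelikeEmbedding (g : LorentzMetric N) (Φ : S → N) : Prop where
  embedding : Manifold.IsSmoothEmbedding (𝓡 2) (𝓡 4) ∞ Φ
  spacelike : ∀ (p : S) (X : TangentSpace (𝓡 2) p), X ≠ 0 → 0 < induced g Φ p X X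

/-- `w` is in the fiber at `p` of the normal bundle. -/
def IsNormal (g : LorentzMetric N) (Φ : S → N) (p : S) (w : TangentSpace (𝓡 4) (Φ p)) : Prop :=
  ∀ X : TangentSpace (𝓡 2) p, g.val (Φ p) w (differential Φ p X) = 0

/-- A choice of the outward side of the surface, given by a smooth spacelike normal field: the
spacelike vectors of each normal fiber, which has signature `(-,+)`, form two opposite quadrants, and
the outward ones are those in the quadrant of the reference field. -/
structure OutwardDirection (g : LorentzMetric N) (Φ : S → N) where
  /-- The reference field. -/
  field : FieldAlong Φ
  smooth : field.Smooth
  normal : ∀ p, IsNormal g Φ p (field p)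
  spacelike : ∀ p, 0 < g.val (Φ p) (field p) (field p)

/-- `w` is an outward-spacelike vector of the normal fiber at `p`: it is normal, spacelike, and in
the quadrant of the reference field. -/
def OutwardDirection.IsOutward {g : LorentzMetric N} {Φ : S → N} (O : OutwardDirection g Φ) (p : S)
    (w : TangentSpace (𝓡 4) (Φ p)) : Prop :=
  IsNormal g Φ p w ∧ 0 < g.val (Φ p) w w ∧ 0 < g.val (Φ p) w (O.field p)

/-- The orthogonal projection of `T_{Φ(p)}N` onto the normal fiber at `p`, i.e. the identity minus
the tangential part. -/
def normalProj (g : LorentzMetric N) (Φ : S → N) (p : S) :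
    TangentSpace (𝓡 4) (Φ p) →L[ℝ] TangentSpace (𝓡 4) (Φ p) :=
  ContinuousLinearMap.id ℝ _ - (differential Φ p) ∘L (induced g Φ p).inverse ∘L
    (ContinuousLinearMap.precomp ℝ (differential Φ p)) ∘L (g.val (Φ p))

/-- The Levi-Civita covariant derivative `X ↦ ∇_X V` at `p` of a vector field `V` along `Φ`. In the
preferred chart of `N` around `Φ(p)`,
`(∇_X V)ᵏ = X(Vᵏ) + Γᵏᵢⱼ dΦ(X)ⁱ Vʲ`. -/
def covDeriv (g : LorentzMetric N) (Φ : S → N) (V : FieldAlong Φ) (p : S) :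
    TangentSpace (𝓡 2) p →L[ℝ] TangentSpace (𝓡 4) (Φ p) :=
  let dV : TangentSpace (𝓡 2) p →L[ℝ] Coord 4 :=
    mfderiv (𝓡 2) 𝓘(ℝ, Coord 4) (fun q => comps (Φ p) (Φ q) (V q)) p
  (frame (Φ p) (Φ p)) ∘L
    (dV + (christoffel g.val (Φ p) (comps (Φ p) (Φ p) (V p))) ∘L
      (comps (Φ p) (Φ p)) ∘L (differential Φ p))

/-- The normal connection `X ↦ ∇^⊥_X V` at `p`. -/
def normalCovDeriv (g : LorentzMetric N) (Φ : S → N) (V : FieldAlong Φ) (p : S) :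
    TangentSpace (𝓡 2) p →L[ℝ] TangentSpace (𝓡 4) (Φ p) :=
  (normalProj g Φ p) ∘L (covDeriv g Φ V p)

/-- `(u, v)` is an orthonormal basis of the normal fiber at `p` with `u` future-timelike and `v`
outward-spacelike. -/
structure IsAdaptedFrame {g : LorentzMetric N} {Φ : S → N} (T : TimeOrientation g)
    (O : OutwardDirection g Φ) (p : S) (u v : TangentSpace (𝓡 4) (Φ p)) : Prop where
  normal : IsNormal g Φ p u
  future : T.IsFuture (Φ p) u
  outward : O.IsOutward p v
  unit_timelike : g.val (Φ p) u u = -1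
  unit_spacelike : g.val (Φ p) v v = 1
  orthogonal : g.val (Φ p) u v = 0

/-- The outward member of the adapted frame obtained by normalizing the reference fields. -/
def refOut {g : LorentzMetric N} {Φ : S → N} (O : OutwardDirection g Φ) (p : S) :
    TangentSpace (𝓡 4) (Φ p) :=
  (√ (g.val (Φ p) (O.field p) (O.field p)))⁻¹ • O.field p

/-- The component of the time-orienting field orthogonal to the surface and to `refOut`. -/
def refTimeAux {g : LorentzMetric N} {Φ : S → N} (T : TimeOrientation g)
    (O : OutwardDirection g Φ) (p : S) : TangentSpace (𝓡 4) (Φ p) :=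
  normalProj g Φ p (T.field (Φ p)) - (g.val (Φ p) (T.field (Φ p)) (refOut O p)) • refOut O p

/-- The future member of the adapted frame obtained by normalizing the reference fields. -/
def refTime {g : LorentzMetric N} {Φ : S → N} (T : TimeOrientation g)
    (O : OutwardDirection g Φ) (p : S) : TangentSpace (𝓡 4) (Φ p) :=
  (√ (-g.val (Φ p) (refTimeAux T O p) (refTimeAux T O p)))⁻¹ • refTimeAux T O p

/-- The involution `w ↦ w^⊥` of the normal fiber at `p`: for an orthonormal basis `(u, v)` of the
fiber with `u` future-timelike and `v` outward-spacelike, it is the linear map that exchanges `u` and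
`v`. It does not depend on the basis (see `perp_adapted`); the formula uses the basis
`(refTime, refOut)`. -/
def perp {g : LorentzMetric N} {Φ : S → N} (T : TimeOrientation g)
    (O : OutwardDirection g Φ) (p : S) (w : TangentSpace (𝓡 4) (Φ p)) :
    TangentSpace (𝓡 4) (Φ p) :=
  (g.val (Φ p) w (refOut O p)) • refTime T O p - (g.val (Φ p) w (refTime T O p)) • refOut O p

/-- `ν` is a (smooth) outward-spacelike section of unit length of the normal bundle. -/
structure IsUnitOutwardNormal {g : LorentzMetric N} {Φ : S → N} (O : OutwardDirection g Φ)
    (ν : FieldAlong Φ) : Prop where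
  smooth : ν.Smooth
  outward : ∀ p, O.IsOutward p (ν p)
  unit : ∀ p, g.val (Φ p) (ν p) (ν p) = 1

/-- The connection 1-form `α_ν(X) = ⟨∇^⊥_X ν, ν^⊥⟩`. -/
def connectionForm {g : LorentzMetric N} {Φ : S → N} (T : TimeOrientation g)
    (O : OutwardDirection g Φ) (ν : FieldAlong Φ) : OneForm 2 S := fun p =>
  (g.val (Φ p) (perp T O p (ν p))) ∘L (normalCovDeriv g Φ ν p)

/-- The functional `C(ν) = ∫_S |α_ν|² dA`. -/
def energy [MeasurableSpace S] {g : LorentzMetric N} {Φ : S → N} (T : TimeOrientation g)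
    (O : OutwardDirection g Φ) (ν : FieldAlong Φ) : ℝ :=
  ∫ p, normSq (induced g Φ) (connectionForm T O ν) p ∂(area (induced g Φ))

end Spacetime

/-! ### The involution `w ↦ w^⊥` does not depend on the adapted frame -/

/-- On a finite-dimensional space, an injective bilinear form has a genuine inverse. -/
lemma bilin_apply_inverse {E : Type*} [NormedAddCommGroup E] [NormedSpace ℝ E]
    [FiniteDimensional ℝ E] (B : E →L[ℝ] E →L[ℝ] ℝ) (hB : ∀ X, B X = 0 → X = 0)
    (l : E →L[ℝ] ℝ) : B (B.inverse l) = l := by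
  have hinj : Function.Injective B.toLinearMap :=
    (injective_iff_map_eq_zero B.toLinearMap).2 hB
  have hdim : Module.finrank ℝ E = Module.finrank ℝ (E →L[ℝ] ℝ) := by
    rw [(LinearMap.toContinuousLinearMap (𝕜 := ℝ) (E := E) (F' := ℝ)).symm.finrank_eq]
    exact (Subspace.dual_finrank_eq (K := ℝ) (V := E)).symm
  have e : ∃ e : E ≃L[ℝ] (E →L[ℝ] ℝ), (e : E →L[ℝ] E →L[ℝ] ℝ) = B := by
    refine ⟨(LinearEquiv.ofInjectiveOfFinrankEq B.toLinearMap hinj hdim).toContinuousLinearEquiv,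
      ?_⟩
    ext x y
    rfl
  exact ContinuousLinearMap.IsInvertible.self_apply_inverse e l

section PerpWellDefined

variable {N : Type*} [TopologicalSpace N] [ChartedSpace (Coord 4) N] [IsManifold (𝓡 4) ∞ N]
  {S : Type*} [TopologicalSpace S] [ChartedSpace (Coord 2) S]

lemma isNormal_normalProj {g : LorentzMetric N} {Φ : S → N} (hΦ : IsSpacelikeEmbedding g Φ)
    (p : S) (w : TangentSpace (𝓡 4) (Φ p)) : IsNormal g Φ p (normalProj g Φ p w) := by
  intro X
  have key : induced g Φ p ((induced g Φ p).inverse ((g.val (Φ p) w) ∘L (differential Φ p))) =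
      (g.val (Φ p) w) ∘L (differential Φ p) := by
    refine bilin_apply_inverse (E := Coord 2) (induced g Φ p) (fun X hX => ?_) _
    by_contra h
    have h1 := hΦ.spacelike p X h
    have h2 : induced g Φ p X X = 0 := congrArg (fun l => l X) hX
    exact absurd h1 (by rw [h2]; exact lt_irrefl _)
  have h3 : g.val (Φ p) (normalProj g Φ p w) = g.val (Φ p) w - g.val (Φ p) (differential Φ p
      ((induced g Φ p).inverse ((g.val (Φ p) w) ∘L (differential Φ p)))) := map_sub _ _ _
  have h4 : g.val (Φ p) (differential Φ p
      ((induced g Φ p).inverse ((g.val (Φ p) w) ∘L (differential Φ p)))) (differential Φ p X) =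
      g.val (Φ p) w (differential Φ p X) := congrArg (fun l => l X) key
  rw [h3]
  exact sub_eq_zero.2 h4.symm

lemma nondegenerate (g : LorentzMetric N) (x : N) (z : TangentSpace (𝓡 4) x)
    (hz : ∀ w, g.val x z w = 0) : z = 0 := by
  obtain ⟨e, he⟩ := g.signature x
  rw [← e.sum_repr z] at hz ⊢
  refine Finset.sum_eq_zero fun i _ => ?_
  have h := hz (e i)
  have h2 : g.val x (∑ j, e.repr z j • e j) (e i) = ∑ j, e.repr z j * g.val x (e j) (e i) := by
    rw [map_sum]
    simp
  rw [h2] at h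
  have h3 : e.repr z i = 0 := by
    simp only [he] at h
    simp only [mul_ite, mul_zero, Finset.sum_ite_eq', Finset.mem_univ,
      if_true] at h
    split_ifs at h <;> linarith
  rw [h3]
  exact zero_smul ℝ (e i)

/-- An adapted frame spans the normal fiber. -/
lemma IsAdaptedFrame.expand {g : LorentzMetric N} {Φ : S → N} (hΦ : IsSpacelikeEmbedding g Φ)
    {T : TimeOrientation g} {O : OutwardDirection g Φ} {p : S}
    {u v : TangentSpace (𝓡 4) (Φ p)} (h : IsAdaptedFrame T O p u v)
    {w : TangentSpace (𝓡 4) (Φ p)} (hw : IsNormal g Φ p w) :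
    w = (g.val (Φ p) w v) • v - (g.val (Φ p) w u) • u := by
  have huu := h.unit_timelike
  have hvv := h.unit_spacelike
  have huv := h.orthogonal
  have hvu : g.val (Φ p) v u = 0 := by rw [g.symm]; exact huv
  let L : (TangentSpace (𝓡 2) p × (ℝ × ℝ)) →ₗ[ℝ] TangentSpace (𝓡 4) (Φ p) :=
    LinearMap.coprod (differential Φ p).toLinearMap
      (LinearMap.coprod (LinearMap.toSpanSingleton ℝ _ u) (LinearMap.toSpanSingleton ℝ _ v))
  have hL : ∀ X a b, L (X, (a, b)) = differential Φ p X + (a • u + b • v) := fun X a b => rfl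
  have hinj : Function.Injective L := by
    refine (injective_iff_map_eq_zero L).2 ?_
    rintro ⟨X, a, b⟩ h0
    rw [hL] at h0
    have h1 : g.val (Φ p) u (differential Φ p X + (a • u + b • v)) = 0 := by rw [h0, map_zero]
    have h2 : g.val (Φ p) v (differential Φ p X + (a • u + b • v)) = 0 := by rw [h0, map_zero]
    simp only [map_add, map_smul, smul_eq_mul, h.normal X, h.outward.1 X, huu, hvv, huv, hvu]
      at h1 h2
    have ha : a = 0 := by linarith
    have hb : b = 0 := by linarith
    subst ha hb
    have hX : X = 0 := by
      by_contra hne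
      have h3 := hΦ.spacelike p X hne
      have h4 : differential Φ p X = 0 := by simpa using h0
      have h5 : induced g Φ p X X = g.val (Φ p) (differential Φ p X) (differential Φ p X) := rfl
      rw [h5, h4, map_zero] at h3
      exact lt_irrefl _ h3
    rw [hX]
    rfl
  have hdim : Module.finrank ℝ (TangentSpace (𝓡 2) p × (ℝ × ℝ)) =
      Module.finrank ℝ (TangentSpace (𝓡 4) (Φ p)) := by
    have h2 : Module.finrank ℝ (TangentSpace (𝓡 2) p) = 2 := finrank_euclideanSpace_fin
    have h4 : Module.finrank ℝ (TangentSpace (𝓡 4) (Φ p)) = 4 := finrank_euclideanSpace_fin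
    have : FiniteDimensional ℝ (TangentSpace (𝓡 2) p) :=
      inferInstanceAs (FiniteDimensional ℝ (Coord 2))
    rw [Module.finrank_prod, Module.finrank_prod, h2, h4]
    simp
  have hsurj : Function.Surjective L := by
    have : FiniteDimensional ℝ (TangentSpace (𝓡 2) p) :=
      inferInstanceAs (FiniteDimensional ℝ (Coord 2))
    have : FiniteDimensional ℝ (TangentSpace (𝓡 4) (Φ p)) :=
      inferInstanceAs (FiniteDimensional ℝ (Coord 4))
    exact (LinearMap.injective_iff_surjective_of_finrank_eq_finrank hdim).1 hinj
  have hz : w - ((g.val (Φ p) w v) • v - (g.val (Φ p) w u) • u) = 0 := by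
    refine nondegenerate g (Φ p) _ fun y => ?_
    obtain ⟨⟨X, a, b⟩, rfl⟩ := hsurj y
    rw [hL, map_sub, map_sub, map_smul, map_smul]
    simp only [sub_apply, smul_apply, map_add, map_smul,
      smul_eq_mul, h.normal X, h.outward.1 X, hw X, huu, hvv, huv, hvu]
    ring
  exact sub_eq_zero.1 hz

/-- The involution exchanges the two members of every adapted frame. -/
theorem perp_adapted {g : LorentzMetric N} {Φ : S → N} (hΦ : IsSpacelikeEmbedding g Φ)
    {T : TimeOrientation g} {O : OutwardDirection g Φ} {p : S}
    {u v : TangentSpace (𝓡 4) (Φ p)} (h : IsAdaptedFrame T O p u v) :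
    perp T O p u = v ∧ perp T O p v = u := by
  have huu := h.unit_timelike
  have hvv := h.unit_spacelike
  have huv := h.orthogonal
  have hvu : g.val (Φ p) v u = 0 := by rw [g.symm]; exact huv
  -- scalar products of normal vectors in the frame
  have gram : ∀ a b c d : ℝ, g.val (Φ p) (a • u + b • v) (c • u + d • v) = b * d - a * c := by
    intro a b c d
    rw [map_add, map_smul, map_smul]
    simp only [add_apply, smul_apply, map_add, map_smul,
      smul_eq_mul, huu, hvv, huv, hvu]
    ring
  have span : ∀ w, IsNormal g Φ p w → ∃ a b : ℝ, w = a • u + b • v ∧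
      a = -g.val (Φ p) w u ∧ b = g.val (Φ p) w v := fun w hw =>
    ⟨-g.val (Φ p) w u, g.val (Φ p) w v, by
      conv_lhs => rw [h.expand hΦ hw]
      module, rfl, rfl⟩
  -- the outward member of the reference frame
  obtain ⟨a, b, hη, -, hb⟩ := span _ (O.normal p)
  have hb0 : 0 < b := by rw [hb, g.symm]; exact h.outward.2.2
  have hη2 : 0 < b * b - a * a := by
    have := O.spacelike p
    rwa [hη, gram] at this
  set r : ℝ := √ (b * b - a * a) with hr
  have hr0 : 0 < r := Real.sqrt_pos.2 hη2
  have hr2 : r * r = b * b - a * a := Real.mul_self_sqrt hη2.le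
  have hv0 : refOut O p = (r⁻¹ * a) • u + (r⁻¹ * b) • v := by
    rw [refOut, hη, gram, ← hr]
    module
  obtain ⟨s, hs⟩ : ∃ s, s = r⁻¹ * a := ⟨_, rfl⟩
  obtain ⟨c, hc⟩ : ∃ c, c = r⁻¹ * b := ⟨_, rfl⟩
  rw [← hs, ← hc] at hv0
  have hcpos : 0 < c := by rw [hc]; positivity
  have hcs : c * c - s * s = 1 := by
    have : c * c - s * s = r⁻¹ * r⁻¹ * (r * r) := by rw [hr2, hs, hc]; ring
    rw [this]
    field_simp
  -- the future member
  obtain ⟨x, y, ht, -, -⟩ := span _ (isNormal_normalProj hΦ p (T.field (Φ p)))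
  obtain ⟨X, hX⟩ : ∃ X, T.field (Φ p) = normalProj g Φ p (T.field (Φ p)) + differential Φ p X :=
    ⟨(induced g Φ p).inverse ((g.val (Φ p) (T.field (Φ p))) ∘L (differential Φ p)),
      (sub_add_cancel _ _).symm⟩
  rw [ht] at hX
  have hTn : ∀ α β : ℝ, g.val (Φ p) (T.field (Φ p)) (α • u + β • v) = y * β - x * α := by
    intro α β
    rw [hX, map_add (g.val (Φ p)) (x • u + y • v), add_apply, gram, g.symm (Φ p) (differential Φ p X)]
    rw [map_add, map_smul, map_smul]
    simp only [add_apply, smul_apply, h.normal X,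
      h.outward.1 X]
    simp
  have hx : 0 < x := by
    have h1 := h.future.2
    have h2 := hTn 1 0
    rw [g.symm] at h1
    simp only [one_smul, zero_smul, add_zero] at h2
    linarith
  have hxy : y * y < x * x := by
    have h1 := T.timelike (Φ p)
    have h2 : g.val (Φ p) (T.field (Φ p)) (T.field (Φ p)) =
        y * y - x * x + g.val (Φ p) (differential Φ p X) (differential Φ p X) := by
      have h3 := hTn x y
      have h4 : g.val (Φ p) (T.field (Φ p)) (differential Φ p X) =
          g.val (Φ p) (differential Φ p X) (differential Φ p X) := by
        conv_lhs => rw [hX]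
        rw [map_add, map_add, map_smul, map_smul]
        simp only [add_apply, smul_apply, h.normal X,
          h.outward.1 X]
        simp
      rw [← h3, ← h4, ← map_add, ← hX]
    have h5 : 0 ≤ g.val (Φ p) (differential Φ p X) (differential Φ p X) := by
      by_cases h0 : X = 0
      · rw [h0]; simp
      · exact (hΦ.spacelike p X h0).le
    linarith
  have hk : 0 < c * x - s * y := by
    have h1 : (s * y) ^ 2 < (c * x) ^ 2 := by
      nlinarith [mul_pos hx hx, mul_self_nonneg s, mul_self_nonneg y, mul_self_nonneg c]
    have h2 := abs_lt_of_sq_lt_sq h1 (by positivity)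
    linarith [(abs_lt.1 h2).2, le_abs_self (s * y)]
  obtain ⟨k, hkk⟩ : ∃ k, k = c * x - s * y := ⟨_, rfl⟩
  rw [← hkk] at hk
  have hτ : refTimeAux T O p = (k * c) • u + (k * s) • v := by
    have h1 : refTimeAux T O p = (x - (y * c - x * s) * s) • u + (y - (y * c - x * s) * c) • v := by
      rw [refTimeAux, hv0, hTn, ht]
      module
    have e1 : x - (y * c - x * s) * s = k * c := by
      rw [hkk]; linear_combination (-x) * hcs
    have e2 : y - (y * c - x * s) * c = k * s := by
      rw [hkk]; linear_combination (-y) * hcs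
    rw [h1, e1, e2]
  have hu0 : refTime T O p = c • u + s • v := by
    have h1 : -(k * s * (k * s) - k * c * (k * c)) = k * k := by
      linear_combination (k * k) * hcs
    rw [refTime, hτ, gram, h1, Real.sqrt_mul_self hk.le, smul_add, smul_smul, smul_smul,
      inv_mul_cancel_left₀ hk.ne', inv_mul_cancel_left₀ hk.ne']
  have hu1 : ∀ α β : ℝ, g.val (Φ p) u (α • u + β • v) = -α := by
    intro α β
    have := gram 1 0 α β
    simp only [one_smul, zero_smul, add_zero] at this
    linarith
  have hv1 : ∀ α β : ℝ, g.val (Φ p) v (α • u + β • v) = β := by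
    intro α β
    have := gram 0 1 α β
    simp only [one_smul, zero_smul, zero_add] at this
    linarith
  constructor
  · rw [perp, hu0, hv0, hu1, hu1]
    have e : (-s) • (c • u + s • v) - (-c) • (s • u + c • v) = (c * c - s * s) • v := by module
    rw [e, hcs, one_smul]
  · rw [perp, hu0, hv0, hv1, hv1]
    have e : c • (c • u + s • v) - s • (s • u + c • v) = (c * c - s * s) • u := by module
    rw [e, hcs, one_smul]

end PerpWellDefined

end StraightOut

end

/-! The unit outward-spacelike vectors of a normal fiber form one branch of a hyperbola, and the
hyperbolic rotations act simply transitively on it. Hence every competitor has the form `μ = cosh f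
• ν + sinh f • ν^⊥` for a smooth function `f`, and every smooth `f` occurs
(`IsUnitOutwardNormal.rotate`, `IsUnitOutwardNormal.exists_rotate`). Since the normal connection is
metric, the connection form changes by an exact form, `α_μ = α_ν - df` (`connectionForm_rotate`).

The question is thereby reduced to a convex quadratic problem on a closed Riemannian manifold: when
does a 1-form `a` have least `L²` norm among all `a - df`? Expanding the square and integrating by
parts gives `∫|a - df|² = ∫|a|² + 2∫ f div a + ∫|df|²` (`integral_normSq_sub_dForm`). If `div a =
0`, the right side is at least `∫|a|²`. If `a` is minimal, replacing `f` by `t f` makes the linear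
term vanish for every `f`, so `div a = 0` (`forall_integral_normSq_le_iff`). No existence theorem
for minimizers or for Poisson's equation enters.

Most of the work is to derive the classical calculus from the definitions in charts. The measure
`area` is a supremum of chart measures, and must be shown to restrict to each of them. The
divergence and the covariant derivative are computed at each point in the chart belonging to that
point, so both need expressions valid in one fixed chart near the point before they can be
integrated or differentiated (`divCoord_eq_divCoord`, `metric_covDeriv`). -/

noncomputable section

set_option linter.unusedSectionVars false

namespace StraightOut

/-! ### Maps and tangent vectors in chart coordinates. -/

section ChartCalculus

open Filter Topology

variable {n : ℕ} {M : Type*} [TopologicalSpace M] [ChartedSpace (Coord n) M]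
  [IsManifold (𝓡 n) ∞ M]
  {m : ℕ} {M' : Type*} [TopologicalSpace M'] [ChartedSpace (Coord m) M']
  [IsManifold (𝓡 m) ∞ M']
  {F : Type*} [NormedAddCommGroup F] [NormedSpace ℝ F]

lemma comps_frame {x₀ x : M} (hx : x ∈ (extChartAt (𝓡 n) x₀).source) (c : Coord n) :
    comps (n := n) x₀ x (frame x₀ x c) = c := by
  rw [extChartAt_source] at hx
  exact (trivializationAt (Coord n) (TangentSpace (𝓡 n)) x₀).continuousLinearMapAt_symmL
    (by simpa using hx) c

lemma frame_comps {x₀ x : M} (hx : x ∈ (extChartAt (𝓡 n) x₀).source)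
    (v : TangentSpace (𝓡 n) x) : frame x₀ x (comps (n := n) x₀ x v) = v := by
  rw [extChartAt_source] at hx
  exact (trivializationAt (Coord n) (TangentSpace (𝓡 n)) x₀).symmL_continuousLinearMapAt
    (by simpa using hx) v

/-- Together with its counterpart for the inverse chart, this identifies `comps` and `frame` with
derivatives of charts, so that the chain rule turns manifold derivatives into ordinary ones. -/
lemma hasMFDerivAt_extChartAt_comps {x₀ x : M} (hx : x ∈ (extChartAt (𝓡 n) x₀).source) :
    HasMFDerivAt (𝓡 n) 𝓘(ℝ, Coord n) (extChartAt (𝓡 n) x₀) x (comps x₀ x) := by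
  rw [extChartAt_source] at hx
  have h : MDifferentiableAt (𝓡 n) 𝓘(ℝ, Coord n) (extChartAt (𝓡 n) x₀) x :=
    mdifferentiableAt_extChartAt hx
  have := h.hasMFDerivAt
  rwa [← TangentBundle.continuousLinearMapAt_trivializationAt hx] at this

lemma hasMFDerivAt_extChartAt_symm_frame {x₀ : M} {y : Coord n}
    (hy : y ∈ (extChartAt (𝓡 n) x₀).target) :
    HasMFDerivAt 𝓘(ℝ, Coord n) (𝓡 n) (extChartAt (𝓡 n) x₀).symm y
      (frame x₀ ((extChartAt (𝓡 n) x₀).symm y)) := by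
  have hs := (extChartAt (𝓡 n) x₀).map_target hy
  rw [extChartAt_source] at hs
  have h : MDifferentiableWithinAt 𝓘(ℝ, Coord n) (𝓡 n) (extChartAt (𝓡 n) x₀).symm
      (range (𝓡 n)) y := mdifferentiableWithinAt_extChartAt_symm hy
  have h2 := h.hasMFDerivWithinAt
  have h3 := TangentBundle.symmL_trivializationAt (I := 𝓡 n) (𝕜 := ℝ) hs
  rw [(extChartAt (𝓡 n) x₀).right_inv hy] at h3
  -- The model has no boundary, so the derivative within its range is a full derivative.
  rw [← h3, ModelWithCorners.range_eq_univ] at h2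
  exact hasMFDerivWithinAt_univ.1 h2

lemma MDifferentiableAt.hasFDerivAt_localRep {f : M → F} {x₀ : M} {y : Coord n}
    (hy : y ∈ (extChartAt (𝓡 n) x₀).target)
    (hf : MDifferentiableAt (𝓡 n) 𝓘(ℝ, F) f ((extChartAt (𝓡 n) x₀).symm y)) :
    HasFDerivAt (fun y => f ((extChartAt (𝓡 n) x₀).symm y))
      ((mfderiv (𝓡 n) 𝓘(ℝ, F) f ((extChartAt (𝓡 n) x₀).symm y)) ∘L
        (frame x₀ ((extChartAt (𝓡 n) x₀).symm y))) y :=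
  (hf.hasMFDerivAt.comp y (hasMFDerivAt_extChartAt_symm_frame hy)).hasFDerivAt

/-- A map between manifolds read in the preferred charts around `x₀` and `z₀`. -/
def mapCoord (f : M → M') (x₀ : M) (z₀ : M') (y : Coord n) : Coord m :=
  extChartAt (𝓡 m) z₀ (f ((extChartAt (𝓡 n) x₀).symm y))

/-- The part of the chart domain around `x₀` that `f` sends to the chart domain around `z₀`, in
coordinates. -/
def mapDomain (f : M → M') (x₀ : M) (z₀ : M') : Set (Coord n) :=
  (extChartAt (𝓡 n) x₀).target ∩
    (extChartAt (𝓡 n) x₀).symm ⁻¹' (f ⁻¹' (extChartAt (𝓡 m) z₀).source)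

lemma isOpen_mapDomain {f : M → M'} (hf : Continuous f) (x₀ : M) (z₀ : M') :
    IsOpen (mapDomain (n := n) (m := m) f x₀ z₀) :=
  (continuousOn_extChartAt_symm x₀).isOpen_inter_preimage (isOpen_extChartAt_target x₀)
    ((isOpen_extChartAt_source z₀).preimage hf)

lemma mem_mapDomain_self (f : M → M') {x₀ : M} {y : Coord n}
    (hy : y ∈ (extChartAt (𝓡 n) x₀).target) :
    y ∈ mapDomain (n := n) (m := m) f x₀ (f ((extChartAt (𝓡 n) x₀).symm y)) :=
  ⟨hy, mem_extChartAt_source _⟩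

lemma MDifferentiableAt.hasFDerivAt_mapCoord {f : M → M'} {x₀ : M} {z₀ : M'} {y : Coord n}
    (hy : y ∈ mapDomain (n := n) (m := m) f x₀ z₀)
    (hf : MDifferentiableAt (𝓡 n) (𝓡 m) f ((extChartAt (𝓡 n) x₀).symm y)) :
    HasFDerivAt (mapCoord (n := n) (m := m) f x₀ z₀)
      ((comps z₀ (f ((extChartAt (𝓡 n) x₀).symm y))) ∘L
        (mfderiv (𝓡 n) (𝓡 m) f ((extChartAt (𝓡 n) x₀).symm y)) ∘L
        (frame x₀ ((extChartAt (𝓡 n) x₀).symm y))) y :=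
  ((hasMFDerivAt_extChartAt_comps hy.2).comp y
    (hf.hasMFDerivAt.comp y (hasMFDerivAt_extChartAt_symm_frame hy.1))).hasFDerivAt

lemma ContMDiff.contDiffOn_localRep {k : ℕ∞} {f : M → F}
    (hf : ContMDiff (𝓡 n) 𝓘(ℝ, F) k f) (x₀ : M) :
    ContDiffOn ℝ k (fun y => f ((extChartAt (𝓡 n) x₀).symm y)) (extChartAt (𝓡 n) x₀).target := by
  rw [← contMDiffOn_iff_contDiffOn]
  exact hf.comp_contMDiffOn ((contMDiffOn_extChartAt_symm (n := ∞) x₀).of_le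
    (by exact_mod_cast le_top))

lemma contMDiffAt_of_localRep {k : ℕ∞} {f : M → F} {x : M}
    (hf : ContDiffAt ℝ k (fun y => f ((extChartAt (𝓡 n) x).symm y)) (extChartAt (𝓡 n) x x)) :
    ContMDiffAt (𝓡 n) 𝓘(ℝ, F) k f x := by
  have h1 : ContMDiffAt (𝓡 n) 𝓘(ℝ, Coord n) k (extChartAt (𝓡 n) x) x :=
    (contMDiffAt_extChartAt (n := ∞)).of_le (by exact_mod_cast le_top)
  have h2 := ContMDiffAt.comp x hf.contMDiffAt h1
  refine h2.congr_of_eventuallyEq ?_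
  filter_upwards [extChartAt_source_mem_nhds (I := 𝓡 n) x] with q hq
  exact congrArg f ((extChartAt (𝓡 n) x).left_inv hq).symm

lemma ContMDiff.contDiffOn_mapCoord {k : ℕ∞} {f : M → M'}
    (hf : ContMDiff (𝓡 n) (𝓡 m) k f) (x₀ : M) (z₀ : M') :
    ContDiffOn ℝ k (mapCoord (n := n) (m := m) f x₀ z₀)
      (mapDomain (n := n) (m := m) f x₀ z₀) := by
  have hk : (k : WithTop ℕ∞) ≤ ∞ := by exact_mod_cast le_top
  rw [← contMDiffOn_iff_contDiffOn]
  have h1 : ContMDiffOn (𝓡 m) 𝓘(ℝ, Coord m) k (extChartAt (𝓡 m) z₀) (extChartAt (𝓡 m) z₀).source := by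
    rw [extChartAt_source]
    exact (contMDiffOn_extChartAt (n := ∞)).of_le hk
  have h2 := hf.comp_contMDiffOn ((contMDiffOn_extChartAt_symm (n := ∞) x₀).of_le hk)
  exact h1.comp (h2.mono inter_subset_left) fun y hy => hy.2

end ChartCalculus

/-! ### The Gram determinant of a bilinear form. -/

section GramDeterminant

variable {n : ℕ}

/-- The determinant of the Gram matrix of a bilinear form on `ℝⁿ`. -/
def gramDet (B : Coord n →L[ℝ] Coord n →L[ℝ] ℝ) : ℝ :=
  Matrix.det (Matrix.of fun i j : Fin n =>
    B (EuclideanSpace.single i 1) (EuclideanSpace.single j 1))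

/-- The pullback of a bilinear form. -/
def pullbackForm {E F : Type*} [NormedAddCommGroup E] [NormedSpace ℝ E] [NormedAddCommGroup F]
    [NormedSpace ℝ F] (B : F →L[ℝ] F →L[ℝ] ℝ) (P : E →L[ℝ] F) : E →L[ℝ] E →L[ℝ] ℝ :=
  (ContinuousLinearMap.precomp ℝ P) ∘L B ∘L P

@[simp] lemma pullbackForm_apply {E F : Type*} [NormedAddCommGroup E] [NormedSpace ℝ E]
    [NormedAddCommGroup F] [NormedSpace ℝ F] (B : F →L[ℝ] F →L[ℝ] ℝ) (P : E →L[ℝ] F) (c d : E) :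
    pullbackForm B P c d = B (P c) (P d) := rfl

/-- In matrices the pullback is `Pᵀ B P`. This is the source of the Jacobian factor in the change of
variables for the area density. -/
lemma gramDet_pullbackForm (B : Coord n →L[ℝ] Coord n →L[ℝ] ℝ) (P : Coord n →L[ℝ] Coord n) :
    gramDet (pullbackForm B P) = P.det ^ 2 * gramDet B := by
  let b := (EuclideanSpace.basisFun (Fin n) ℝ).toBasis
  let toBil (B : Coord n →L[ℝ] Coord n →L[ℝ] ℝ) : LinearMap.BilinForm ℝ (Coord n) :=
    LinearMap.mk₂ ℝ (fun c d => B c d) (by simp) (by simp) (by simp) (by simp)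
  have key : ∀ B, gramDet B = (LinearMap.BilinForm.toMatrix b (toBil B)).det := by
    intro B
    rw [gramDet]
    congr 1
  have h2 : toBil (pullbackForm B P) = (toBil B).comp P.toLinearMap P.toLinearMap := by
    ext
    rfl
  rw [key, key, h2, LinearMap.BilinForm.toMatrix_comp b b, Matrix.det_mul, Matrix.det_mul,
    Matrix.det_transpose, LinearMap.det_toMatrix]
  change _ = LinearMap.det P.toLinearMap ^ 2 * _
  ring

lemma gramDet_pos {B : Coord n →L[ℝ] Coord n →L[ℝ] ℝ} (hsymm : ∀ c d, B c d = B d c)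
    (hpos : ∀ c, c ≠ 0 → 0 < B c c) : 0 < gramDet B := by
  refine Matrix.PosDef.det_pos (Matrix.PosDef.of_dotProduct_mulVec_pos ?_ fun x hx => ?_)
  · ext i j
    simp [hsymm]
  · have hx' : WithLp.toLp 2 x ≠ (0 : Coord n) := fun h => hx (by simpa using h)
    have e : (WithLp.toLp 2 x : Coord n) = ∑ i, x i • EuclideanSpace.single i (1 : ℝ) := by
      ext j
      simp [Pi.single_apply]
    have h := hpos _ hx'
    rw [e] at h
    simp only [map_sum, map_smul, sum_apply, smul_apply,
      smul_eq_mul, Finset.mul_sum] at h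
    rw [Finset.sum_comm] at h
    simpa [dotProduct, Matrix.mulVec, Finset.mul_sum, mul_comm, mul_left_comm] using h

lemma contDiff_gramDet {k : WithTop ℕ∞} :
    ContDiff ℝ k (gramDet : (Coord n →L[ℝ] Coord n →L[ℝ] ℝ) → ℝ) := by
  unfold gramDet
  simp only [Matrix.det_apply, Matrix.of_apply]
  fun_prop

end GramDeterminant

/-! ### Riemannian metrics under change of chart, and the Riemannian measure. -/

section RiemannianMetrics

open Filter Topology

variable {n : ℕ} {M : Type*} [TopologicalSpace M] [ChartedSpace (Coord n) M]
  [IsManifold (𝓡 n) ∞ M]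

/-- A Riemannian metric with continuously differentiable components. -/
structure IsRiemannian (h : BilinField n M) : Prop where
  symm : ∀ (x : M) (v w : TangentSpace (𝓡 n) x), h x v w = h x w v
  pos : ∀ (x : M) (v : TangentSpace (𝓡 n) x), v ≠ 0 → 0 < h x v v
  contDiffOn : ∀ x₀ : M, ContDiffOn ℝ 1 (bilinCoord h x₀) (extChartAt (𝓡 n) x₀).target

lemma bilinCoord_apply (h : BilinField n M) (x₀ : M) (y c d : Coord n) :
    bilinCoord h x₀ y c d = h ((extChartAt (𝓡 n) x₀).symm y)
      (frame x₀ ((extChartAt (𝓡 n) x₀).symm y) c)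
      (frame x₀ ((extChartAt (𝓡 n) x₀).symm y) d) := rfl

lemma density_eq (h : BilinField n M) (x₀ : M) (y : Coord n) :
    density h x₀ y = √ (gramDet (bilinCoord h x₀ y)) := rfl

/-- The coordinates around `x₁` as functions of the coordinates around `x₀`. -/
abbrev transition (x₀ x₁ : M) : Coord n → Coord n := mapCoord (n := n) (m := n) id x₀ x₁

/-- The overlap of the charts around `x₀` and `x₁`, in the coordinates around `x₀`. -/
abbrev overlap (x₀ x₁ : M) : Set (Coord n) := mapDomain (n := n) (m := n) id x₀ x₁

lemma hasFDerivAt_transition {x₀ x₁ : M} {y : Coord n} (hy : y ∈ overlap x₀ x₁) :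
    HasFDerivAt (transition x₀ x₁)
      ((comps (n := n) x₁ ((extChartAt (𝓡 n) x₀).symm y)) ∘L
        (frame x₀ ((extChartAt (𝓡 n) x₀).symm y))) y := by
  have := MDifferentiableAt.hasFDerivAt_mapCoord hy mdifferentiableAt_id
  rwa [mfderiv_id] at this

lemma frame_eq_frame_comp_fderiv {x₀ x₁ : M} {y : Coord n} (hy : y ∈ overlap x₀ x₁)
    (c : Coord n) :
    frame x₀ ((extChartAt (𝓡 n) x₀).symm y) c =
      frame x₁ ((extChartAt (𝓡 n) x₀).symm y) (fderiv ℝ (transition x₀ x₁) y c) := by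
  rw [(hasFDerivAt_transition hy).fderiv]
  exact (frame_comps hy.2 _).symm

lemma symm_transition {x₀ x₁ : M} {y : Coord n} (hy : y ∈ overlap x₀ x₁) :
    (extChartAt (𝓡 n) x₁).symm (transition x₀ x₁ y) = (extChartAt (𝓡 n) x₀).symm y :=
  (extChartAt (𝓡 n) x₁).left_inv hy.2

lemma transition_mem_target {x₀ x₁ : M} {y : Coord n} (hy : y ∈ overlap x₀ x₁) :
    transition x₀ x₁ y ∈ (extChartAt (𝓡 n) x₁).target :=
  (extChartAt (𝓡 n) x₁).map_source hy.2

lemma injOn_transition (x₀ x₁ : M) : InjOn (transition (n := n) x₀ x₁) (overlap x₀ x₁) := by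
  intro y hy z hz hyz
  have h := symm_transition hy
  rw [hyz, symm_transition hz] at h
  exact ((extChartAt (𝓡 n) x₀).symm.injOn hz.1 hy.1 h).symm

lemma bilinCoord_eq_pullbackForm (h : BilinField n M) {x₀ x₁ : M} {y : Coord n}
    (hy : y ∈ overlap x₀ x₁) :
    bilinCoord h x₀ y =
      pullbackForm (bilinCoord h x₁ (transition x₀ x₁ y)) (fderiv ℝ (transition x₀ x₁) y) := by
  ext c d
  rw [pullbackForm_apply, bilinCoord_apply, bilinCoord_apply, symm_transition hy,
    frame_eq_frame_comp_fderiv hy, frame_eq_frame_comp_fderiv hy d]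

/-- The square root of `(det P)²` is `|det P|`, exactly the factor in the change of variables
formula; this is what makes the chart measures compatible. -/
lemma density_eq_abs_det_mul (h : BilinField n M) {x₀ x₁ : M} {y : Coord n}
    (hy : y ∈ overlap x₀ x₁) :
    density h x₀ y =
      |(fderiv ℝ (transition x₀ x₁) y).det| * density h x₁ (transition x₀ x₁ y) := by
  rw [density_eq, density_eq, bilinCoord_eq_pullbackForm h hy, gramDet_pullbackForm,
    Real.sqrt_mul (sq_nonneg _), Real.sqrt_sq_eq_abs]

namespace IsRiemannian

variable {h : BilinField n M} (hh : IsRiemannian h)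
include hh

lemma bilinCoord_symm (x₀ : M) (y c d : Coord n) : bilinCoord h x₀ y c d = bilinCoord h x₀ y d c :=
  hh.symm _ _ _

lemma bilinCoord_pos {x₀ : M} {y : Coord n} (hy : y ∈ (extChartAt (𝓡 n) x₀).target)
    {c : Coord n} (hc : c ≠ 0) : 0 < bilinCoord h x₀ y c c := by
  refine hh.pos _ _ fun h0 => hc ?_
  exact (comps_frame ((extChartAt (𝓡 n) x₀).map_target hy) c).symm.trans
    ((congrArg (comps (n := n) x₀ _) h0).trans (map_zero _))

lemma gramDet_bilinCoord_pos {x₀ : M} {y : Coord n} (hy : y ∈ (extChartAt (𝓡 n) x₀).target) :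
    0 < gramDet (bilinCoord h x₀ y) :=
  gramDet_pos (hh.bilinCoord_symm x₀ y) fun _ hc => hh.bilinCoord_pos hy hc

lemma density_pos {x₀ : M} {y : Coord n} (hy : y ∈ (extChartAt (𝓡 n) x₀).target) :
    0 < density h x₀ y :=
  Real.sqrt_pos.2 (hh.gramDet_bilinCoord_pos hy)

lemma contDiffOn_density (x₀ : M) :
    ContDiffOn ℝ 1 (density h x₀) (extChartAt (𝓡 n) x₀).target :=
  (contDiff_gramDet.comp_contDiffOn (hh.contDiffOn x₀)).sqrt
    fun _ hy => (hh.gramDet_bilinCoord_pos hy).ne'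

lemma continuousOn_density (x₀ : M) :
    ContinuousOn (density h x₀) (extChartAt (𝓡 n) x₀).target :=
  (hh.contDiffOn_density x₀).continuousOn

end IsRiemannian

/-! ### The Riemannian measure -/

variable [MeasurableSpace M] [BorelSpace M]

/-- The inverse chart is only controlled on the chart target, where it is continuous; the measure
does not charge the complement. -/
lemma aemeasurable_extChartAt_symm (h : BilinField n M) (x₀ : M) :
    AEMeasurable (extChartAt (𝓡 n) x₀).symm
      ((volume.restrict (extChartAt (𝓡 n) x₀).target).withDensity
      (fun y => ENNReal.ofReal (density h x₀ y))) :=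
  ((continuousOn_extChartAt_symm x₀).aemeasurable
    (isOpen_extChartAt_target x₀).measurableSet).mono_ac (withDensity_absolutelyContinuous _ _)

lemma measurableSet_target_inter_preimage (x₀ : M) {B : Set M} (hB : MeasurableSet B) :
    MeasurableSet ((extChartAt (𝓡 n) x₀).target ∩ (extChartAt (𝓡 n) x₀).symm ⁻¹' B) := by
  have := (continuousOn_extChartAt_symm (I := 𝓡 n) x₀).domRestrict.measurable hB
  have h2 := (MeasurableEmbedding.subtype_coe
    (isOpen_extChartAt_target (I := 𝓡 n) x₀).measurableSet).measurableSet_image.2 this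
  convert h2 using 1
  ext y
  simp [and_comm]

lemma chartArea_apply (h : BilinField n M) (x₀ : M) {B : Set M} (hB : MeasurableSet B) :
    chartArea h x₀ B =
      ∫⁻ y in (extChartAt (𝓡 n) x₀).target ∩ (extChartAt (𝓡 n) x₀).symm ⁻¹' B,
        ENNReal.ofReal (density h x₀ y) := by
  have hm := measurableSet_target_inter_preimage (n := n) x₀ hB
  rw [chartArea, Measure.map_apply_of_aemeasurable (aemeasurable_extChartAt_symm h x₀) hB]
  have e : ((volume.restrict (extChartAt (𝓡 n) x₀).target).withDensity
      (fun y => ENNReal.ofReal (density h x₀ y))) ((extChartAt (𝓡 n) x₀).symm ⁻¹' B) =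
      ((volume.restrict (extChartAt (𝓡 n) x₀).target).withDensity
      (fun y => ENNReal.ofReal (density h x₀ y)))
        ((extChartAt (𝓡 n) x₀).target ∩ (extChartAt (𝓡 n) x₀).symm ⁻¹' B) := by
    have hT : ∀ᵐ y ∂((volume.restrict (extChartAt (𝓡 n) x₀).target).withDensity
        (fun y => ENNReal.ofReal (density h x₀ y))), y ∈ (extChartAt (𝓡 n) x₀).target :=
      (withDensity_absolutelyContinuous _ _).ae_le
        (ae_restrict_mem (isOpen_extChartAt_target x₀).measurableSet)
    refine measure_congr ?_
    filter_upwards [hT] with y hy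
    exact propext ⟨fun h' => ⟨hy, h'⟩, fun h' => h'.2⟩
  rw [e, withDensity_apply _ hm, Measure.restrict_restrict hm, inter_right_comm, inter_self]

/-- The transition map is injective on the overlap, so the change of variables formula applies and
its Jacobian is absorbed by `density_eq_abs_det_mul`. -/
lemma chartArea_apply_eq_of_subset (h : BilinField n M) (x₀ x₁ : M) {B : Set M}
    (hB : MeasurableSet B)
    (hB₀ : B ⊆ (extChartAt (𝓡 n) x₀).source) (hB₁ : B ⊆ (extChartAt (𝓡 n) x₁).source) :
    chartArea h x₀ B = chartArea h x₁ B := by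
  rw [chartArea_apply h x₀ hB, chartArea_apply h x₁ hB]
  set A := (extChartAt (𝓡 n) x₀).target ∩ (extChartAt (𝓡 n) x₀).symm ⁻¹' B with hA
  have hsub : A ⊆ overlap x₀ x₁ := fun y hy => ⟨hy.1, hB₁ hy.2⟩
  have himg : (extChartAt (𝓡 n) x₁).target ∩ (extChartAt (𝓡 n) x₁).symm ⁻¹' B =
      transition x₀ x₁ '' A := by
    ext z
    constructor
    · rintro ⟨hz, hzB⟩
      have hs := hB₀ hzB
      refine ⟨extChartAt (𝓡 n) x₀ ((extChartAt (𝓡 n) x₁).symm z),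
        ⟨(extChartAt (𝓡 n) x₀).map_source hs, ?_⟩, ?_⟩
      · rw [mem_preimage, (extChartAt (𝓡 n) x₀).left_inv hs]
        exact hzB
      · rw [transition, mapCoord, (extChartAt (𝓡 n) x₀).left_inv hs]
        exact (extChartAt (𝓡 n) x₁).right_inv hz
    · rintro ⟨y, hy, rfl⟩
      refine ⟨transition_mem_target (hsub hy), ?_⟩
      rw [mem_preimage, symm_transition (hsub hy)]
      exact hy.2
  rw [himg, lintegral_image_eq_lintegral_abs_det_fderiv_mul volume
    (measurableSet_target_inter_preimage x₀ hB)
    (fun y hy => ((hasFDerivAt_transition (hsub hy)).differentiableAt.hasFDerivAt).hasFDerivWithinAt)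
    ((injOn_transition x₀ x₁).mono hsub)]
  refine setLIntegral_congr_fun (measurableSet_target_inter_preimage x₀ hB) fun y hy => ?_
  rw [← ENNReal.ofReal_mul (abs_nonneg _), ← density_eq_abs_det_mul h (hsub hy)]

lemma chartArea_compl_source (h : BilinField n M) (x₀ : M) :
    chartArea h x₀ (extChartAt (𝓡 n) x₀).sourceᶜ = 0 := by
  rw [chartArea_apply h x₀ (isOpen_extChartAt_source x₀).measurableSet.compl]
  have : (extChartAt (𝓡 n) x₀).target ∩
      (extChartAt (𝓡 n) x₀).symm ⁻¹' (extChartAt (𝓡 n) x₀).sourceᶜ = ∅ := by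
    ext y
    simp only [mem_inter_iff, mem_preimage, mem_compl_iff, mem_empty_iff_false, iff_false, not_and,
      not_not]
    exact fun hy => (extChartAt (𝓡 n) x₀).map_target hy
  rw [this]
  simp

/-- The Riemannian measure restricts to the coordinate measure on each chart domain. -/
lemma area_apply_of_subset [SecondCountableTopology M] (h : BilinField n M) (x₀ : M) {B : Set M}
    (hB : MeasurableSet B) (hB₀ : B ⊆ (extChartAt (𝓡 n) x₀).source) :
    area h B = chartArea h x₀ B := by
  refine le_antisymm ?_ ((le_iSup (fun x => chartArea h x) x₀) B)
  obtain ⟨s, hs, hcov⟩ := TopologicalSpace.countable_cover_nhds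
    (fun x : M => extChartAt_source_mem_nhds (I := 𝓡 n) x)
  rcases isEmpty_or_nonempty M with hM | hM
  · rw [eq_empty_of_isEmpty B]; simp
  have hsne : s.Nonempty := by
    rcases s.eq_empty_or_nonempty with rfl | h'
    · simp at hcov
      exact absurd hcov (by simpa using (empty_ne_univ (α := M)))
    · exact h'
  obtain ⟨e, rfl⟩ := hs.exists_eq_range hsne
  let U : ℕ → Set M := fun i => (extChartAt (𝓡 n) (e i)).source
  have hU : ∀ i, MeasurableSet (U i) := fun i => (isOpen_extChartAt_source _).measurableSet
  have hUcov : ⋃ i, disjointed U i = univ := by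
    rw [iUnion_disjointed]
    simpa [U] using hcov
  -- To bound the supremum from above, one measure is glued from the chart measures along a
  -- countable partition subordinate to chart domains. It agrees with each chart measure on that
  -- chart's domain, hence dominates all of them.
  let μ : Measure M := Measure.sum fun i => (chartArea h (e i)).restrict (disjointed U i)
  have hDm : ∀ i, MeasurableSet (disjointed U i) := fun i => MeasurableSet.disjointed hU i
  have hμ : ∀ (x : M) {C : Set M}, MeasurableSet C → C ⊆ (extChartAt (𝓡 n) x).source →
      μ C = chartArea h x C := by
    intro x C hC hCx
    have e1 : C = ⋃ i, C ∩ disjointed U i := by rw [← inter_iUnion, hUcov, inter_univ]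
    conv_rhs => rw [e1]
    rw [measure_iUnion (fun i j hij => ((disjoint_disjointed U) hij).mono inter_subset_right
      inter_subset_right) (fun i => hC.inter (hDm i)), Measure.sum_apply _ hC]
    refine tsum_congr fun i => ?_
    rw [Measure.restrict_apply hC]
    exact chartArea_apply_eq_of_subset h _ _ (hC.inter (hDm i))
      (inter_subset_right.trans (disjointed_subset U i)) (inter_subset_left.trans hCx)
  have hle : area h ≤ μ := by
    refine iSup_le fun x => Measure.le_iff.2 fun C hC => ?_
    have hS := (isOpen_extChartAt_source (I := 𝓡 n) x).measurableSet
    rw [← measure_inter_add_sdiff C hS]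
    have h0 : chartArea h x (C \ (extChartAt (𝓡 n) x).source) = 0 :=
      measure_mono_null (fun y hy => hy.2) (chartArea_compl_source h x)
    rw [h0, add_zero, ← hμ x (hC.inter hS) inter_subset_right]
    exact measure_mono inter_subset_left
  exact (hle B).trans (hμ x₀ hB hB₀).le

lemma restrict_area [SecondCountableTopology M] (h : BilinField n M) (x₀ : M) :
    (area h).restrict (extChartAt (𝓡 n) x₀).source = chartArea h x₀ := by
  ext B hB
  have hS := (isOpen_extChartAt_source (I := 𝓡 n) x₀).measurableSet
  rw [Measure.restrict_apply hB, area_apply_of_subset h x₀ (hB.inter hS) inter_subset_right,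
    ← measure_inter_add_sdiff B hS,
    measure_mono_null (fun y hy => hy.2 : B \ (extChartAt (𝓡 n) x₀).source ⊆ _)
    (chartArea_compl_source h x₀), add_zero]

lemma setIntegral_area [SecondCountableTopology M] {h : BilinField n M} (hh : IsRiemannian h)
    (x₀ : M) {f : M → ℝ} (hf : ContinuousOn f (extChartAt (𝓡 n) x₀).source) :
    ∫ x in (extChartAt (𝓡 n) x₀).source, f x ∂(area h) =
      ∫ y in (extChartAt (𝓡 n) x₀).target,
        density h x₀ y * f ((extChartAt (𝓡 n) x₀).symm y) := by
  have hf' : AEStronglyMeasurable f (chartArea h x₀) := by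
    rw [← restrict_area]
    exact hf.aestronglyMeasurable (isOpen_extChartAt_source x₀).measurableSet
  have hT := (isOpen_extChartAt_target (I := 𝓡 n) x₀).measurableSet
  rw [restrict_area, chartArea, integral_map (aemeasurable_extChartAt_symm h x₀) hf',
    integral_withDensity_eq_integral_toReal_smul₀
    ((hh.continuousOn_density x₀).aemeasurable hT).ennreal_ofReal (by simp)]
  refine setIntegral_congr_fun hT fun y hy => ?_
  simp only [smul_eq_mul]
  rw [ENNReal.toReal_ofReal (hh.density_pos hy).le]

/-- By compactness, local finiteness is enough. Near a point it holds because the density is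
continuous, hence integrable, on a closed coordinate ball inside the chart target. -/
lemma isFiniteMeasure_area [CompactSpace M] [SecondCountableTopology M] {h : BilinField n M}
    (hh : IsRiemannian h) : IsFiniteMeasure (area h) := by
  have : IsLocallyFiniteMeasure (area h) := by
    refine ⟨fun x => ?_⟩
    have hT := (isOpen_extChartAt_target (I := 𝓡 n) x).mem_nhds (mem_extChartAt_target x)
    obtain ⟨r, hr, hball⟩ := Metric.nhds_basis_closedBall.mem_iff.1 hT
    refine ⟨(extChartAt (𝓡 n) x).source ∩
      (extChartAt (𝓡 n) x) ⁻¹' (Metric.ball (extChartAt (𝓡 n) x x) r), ?_, ?_⟩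
    · exact Filter.inter_mem (extChartAt_source_mem_nhds x)
        ((continuousAt_extChartAt x).preimage_mem_nhds (Metric.ball_mem_nhds _ hr))
    · have hB : MeasurableSet ((extChartAt (𝓡 n) x).source ∩
          (extChartAt (𝓡 n) x) ⁻¹' (Metric.ball (extChartAt (𝓡 n) x x) r)) :=
        ((continuousOn_extChartAt x).isOpen_inter_preimage (isOpen_extChartAt_source x)
          Metric.isOpen_ball).measurableSet
      rw [area_apply_of_subset h x hB inter_subset_left, chartArea_apply h x hB]
      refine (lintegral_mono_set (t := Metric.closedBall (extChartAt (𝓡 n) x x) r) ?_).trans_lt ?_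
      · rintro y ⟨hy, hy2⟩
        have := hy2.2
        rw [mem_preimage, (extChartAt (𝓡 n) x).right_inv hy] at this
        exact Metric.ball_subset_closedBall this
      · have hint : IntegrableOn (density h x) (Metric.closedBall (extChartAt (𝓡 n) x x) r) :=
          ((hh.continuousOn_density x).mono hball).integrableOn_compact
            (isCompact_closedBall _ _)
        exact hint.lintegral_lt_top
  infer_instance

/-- The density is positive in every chart. The statement serves to upgrade almost-everywhere
equality of continuous functions to equality. -/
lemma isOpenPosMeasure_area [SecondCountableTopology M] {h : BilinField n M}
    (hh : IsRiemannian h) : (area h).IsOpenPosMeasure := by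
  refine ⟨fun U hU ⟨x, hx⟩ h0 => ?_⟩
  have hV : IsOpen (U ∩ (extChartAt (𝓡 n) x).source) := hU.inter (isOpen_extChartAt_source x)
  have h1 : area h (U ∩ (extChartAt (𝓡 n) x).source) = 0 :=
    measure_mono_null inter_subset_left h0
  rw [area_apply_of_subset h x hV.measurableSet inter_subset_right,
    chartArea_apply h x hV.measurableSet] at h1
  set A := (extChartAt (𝓡 n) x).target ∩
    (extChartAt (𝓡 n) x).symm ⁻¹' (U ∩ (extChartAt (𝓡 n) x).source)
  have hA : IsOpen A :=
    (continuousOn_extChartAt_symm x).isOpen_inter_preimage (isOpen_extChartAt_target x) hV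
  have hAne : A.Nonempty := ⟨extChartAt (𝓡 n) x x, mem_extChartAt_target x, by
    rw [mem_preimage, extChartAt_to_inv]
    exact ⟨hx, mem_extChartAt_source x⟩⟩
  have hmeas : AEMeasurable (fun y => ENNReal.ofReal (density h x y)) (volume.restrict A) :=
    (((hh.continuousOn_density x).mono inter_subset_left).aemeasurable
      hA.measurableSet).ennreal_ofReal
  rw [lintegral_eq_zero_iff' hmeas] at h1
  have h2 : volume.restrict A = 0 := by
    rw [← ae_eq_bot, ← Filter.eventually_false_iff_eq_bot]
    filter_upwards [h1, ae_restrict_mem hA.measurableSet] with y hy hyA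
    have := hh.density_pos hyA.1
    simp only [Pi.zero_apply, ENNReal.ofReal_eq_zero] at hy
    linarith
  rw [Measure.restrict_eq_zero] at h2
  exact (hA.measure_pos volume hAne).ne' h2

end RiemannianMetrics

/-! ### Integration by parts in a vector space. -/

section IntegrationByParts

variable {E : Type*} [NormedAddCommGroup E] [NormedSpace ℝ E] [FiniteDimensional ℝ E]
  [MeasurableSpace E] [BorelSpace E] {μ : Measure E} [μ.IsAddHaarMeasure]

lemma integrable_of_continuousOn_of_eq_zero {X : Type*} [TopologicalSpace X] [T2Space X]
    [MeasurableSpace X] [OpensMeasurableSpace X] [SecondCountableTopology X] {μ : Measure X}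
    [IsFiniteMeasureOnCompacts μ] {T K : Set X}
    (hK : IsCompact K) (hKT : K ⊆ T) {f : X → ℝ} (hf : ContinuousOn f T)
    (h0 : ∀ x, x ∉ K → f x = 0) : Integrable f μ := by
  have h1 : IntegrableOn f K μ :=
    (hf.mono hKT).integrableOn_compact hK
  refine (integrableOn_iff_integrable_of_support_subset fun x hx => ?_).1 h1
  by_contra hxK
  exact hx (h0 x hxK)

/-- Nothing is asked of `g` outside `T`: every integrand vanishes off the compact set `K`, where `f`
is locally zero. This is what allows functions known only on a chart target. -/
lemma integral_mul_fderiv_eq_neg_of_eq_zero {T K : Set E} (hT : IsOpen T) (hK : IsCompact K)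
    (hKT : K ⊆ T) {f g : E → ℝ} (hf : ContDiffOn ℝ 1 f T) (hg : ContDiffOn ℝ 1 g T)
    (h0 : ∀ x, x ∉ K → f x = 0) (v : E) :
    ∫ x, f x * fderiv ℝ g x v ∂μ = -∫ x, fderiv ℝ f x v * g x ∂μ := by
  have hf0 : ∀ x, x ∉ K → f =ᶠ[nhds x] fun _ => 0 := fun x hx => by
    filter_upwards [hK.isClosed.isOpen_compl.mem_nhds hx] with y hy using h0 y hy
  have hd0 : ∀ x, x ∉ K → fderiv ℝ f x = 0 := fun x hx => by
    rw [(hf0 x hx).fderiv_eq]; simp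
  have hfc : ContinuousOn (fun x => fderiv ℝ f x v) T :=
    (hf.continuousOn_fderiv_of_isOpen hT le_rfl).clm_apply continuousOn_const
  have hgc : ContinuousOn (fun x => fderiv ℝ g x v) T :=
    (hg.continuousOn_fderiv_of_isOpen hT le_rfl).clm_apply continuousOn_const
  have hsupp : tsupport f ⊆ T := by
    refine (closure_minimal (fun x hx => ?_) hK.isClosed).trans hKT
    by_contra hxK
    exact hx (h0 x hxK)
  refine integral_mul_fderiv_eq_neg_fderiv_mul_of_integrable ?_ ?_ ?_ (fun x _ => ?_) fun x hx => ?_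
  · exact integrable_of_continuousOn_of_eq_zero hK hKT (hfc.mul hg.continuousOn)
      fun x hx => by simp [hd0 x hx]
  · exact integrable_of_continuousOn_of_eq_zero hK hKT (hf.continuousOn.mul hgc)
      fun x hx => by simp [h0 x hx]
  · exact integrable_of_continuousOn_of_eq_zero hK hKT (hf.continuousOn.mul hg.continuousOn)
      fun x hx => by simp [h0 x hx]
  · by_cases hx : x ∈ K
    · exact (hf.differentiableOn one_ne_zero).differentiableAt (hT.mem_nhds (hKT hx))
    · exact (hf0 x hx).differentiableAt_iff.2 (differentiableAt_const _)
  · exact (hg.differentiableOn one_ne_zero).differentiableAt (hT.mem_nhds (hsupp hx))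

end IntegrationByParts

/-! ### 1-forms in coordinates and the divergence theorem in one chart. -/

section Forms

open Filter Topology

variable {n : ℕ} {M : Type*} [TopologicalSpace M] [ChartedSpace (Coord n) M]
  [IsManifold (𝓡 n) ∞ M]

/-- The differential of a function, as a 1-form. -/
def dForm (f : M → ℝ) : OneForm n M := fun x => mfderiv (𝓡 n) 𝓘(ℝ, ℝ) f x

lemma formCoord_apply (a : OneForm n M) (x₀ : M) (y c : Coord n) :
    formCoord a x₀ y c = a ((extChartAt (𝓡 n) x₀).symm y)
      (frame x₀ ((extChartAt (𝓡 n) x₀).symm y) c) := rfl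

lemma formCoord_dForm {f : M → ℝ} (hf : ContMDiff (𝓡 n) 𝓘(ℝ, ℝ) 1 f) {x₀ : M} {y : Coord n}
    (hy : y ∈ (extChartAt (𝓡 n) x₀).target) :
    formCoord (dForm f) x₀ y = fderiv ℝ (fun y => f ((extChartAt (𝓡 n) x₀).symm y)) y := by
  have h1 : HasFDerivAt (fun y => f ((extChartAt (𝓡 n) x₀).symm y)) (formCoord (dForm f) x₀ y) y :=
    MDifferentiableAt.hasFDerivAt_localRep hy ((hf _).mdifferentiableAt one_ne_zero)
  exact h1.fderiv.symm

lemma continuousOn_formCoord_dForm {f : M → ℝ} (hf : ContMDiff (𝓡 n) 𝓘(ℝ, ℝ) 1 f) (x₀ : M) :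
    ContinuousOn (formCoord (dForm f) x₀) (extChartAt (𝓡 n) x₀).target := by
  have h1 := ContMDiff.contDiffOn_localRep (k := 1) hf x₀
  exact (h1.continuousOn_fderiv_of_isOpen (isOpen_extChartAt_target x₀) le_rfl).congr
    fun y hy => formCoord_dForm hf hy

/-- The density-weighted components of the dual vector field of a 1-form. -/
def dualCoord (h : BilinField n M) (a : OneForm n M) (x₀ : M) (y : Coord n) : Coord n :=
  density h x₀ y • (bilinCoord h x₀ y).inverse (formCoord a x₀ y)

/-- The divergence in the chart around `x₀`. -/
def divCoord (h : BilinField n M) (a : OneForm n M) (x₀ : M) (y : Coord n) : ℝ :=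
  (density h x₀ y)⁻¹ * ∑ i : Fin n,
    (fderiv ℝ (dualCoord h a x₀) y (EuclideanSpace.single i 1)) i

/-- Positive definite forms are invertible. -/
lemma isInvertible_of_pos {E : Type*} [NormedAddCommGroup E] [NormedSpace ℝ E]
    [FiniteDimensional ℝ E] {B : E →L[ℝ] E →L[ℝ] ℝ} (hB : ∀ c, c ≠ 0 → 0 < B c c) :
    B.IsInvertible := by
  have hinj : Function.Injective B.toLinearMap := by
    refine (injective_iff_map_eq_zero B.toLinearMap).2 fun c hc => ?_
    by_contra hne
    have h1 := hB c hne
    have h2 : B c = 0 := hc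
    rw [h2] at h1
    exact lt_irrefl _ h1
  have hdim : Module.finrank ℝ E = Module.finrank ℝ (E →L[ℝ] ℝ) := by
    rw [(LinearMap.toContinuousLinearMap (𝕜 := ℝ) (E := E) (F' := ℝ)).symm.finrank_eq]
    exact (Subspace.dual_finrank_eq (K := ℝ) (V := E)).symm
  refine ⟨(LinearEquiv.ofInjectiveOfFinrankEq B.toLinearMap hinj hdim).toContinuousLinearEquiv, ?_⟩
  ext x y
  rfl

lemma contDiffAt_inverse_of_pos {E : Type*} [NormedAddCommGroup E] [NormedSpace ℝ E]
    [FiniteDimensional ℝ E] {B : E →L[ℝ] E →L[ℝ] ℝ} (hB : ∀ c, c ≠ 0 → 0 < B c c)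
    {k : WithTop ℕ∞} :
    ContDiffAt ℝ k (ContinuousLinearMap.inverse : (E →L[ℝ] E →L[ℝ] ℝ) → _) B := by
  obtain ⟨e, rfl⟩ := isInvertible_of_pos hB
  have : CompleteSpace E := FiniteDimensional.complete ℝ E
  exact contDiffAt_map_inverse e

namespace IsRiemannian

variable {h : BilinField n M} (hh : IsRiemannian h)
include hh

lemma apply_sharp (a : OneForm n M) (x : M) : h x (sharp h a x) = a x := by
  refine bilin_apply_inverse (E := Coord n) (h x) (fun X hX => ?_) _
  by_contra hne
  have h1 := hh.pos x X hne
  have h2 : h x X X = 0 := congrArg (fun l => l X) hX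
  exact absurd h1 (by rw [h2]; exact lt_irrefl _)

lemma ext_of_apply {x : M} {v w : TangentSpace (𝓡 n) x} (hvw : h x v = h x w) : v = w := by
  by_contra hne
  have h1 := hh.pos x (v - w) (sub_ne_zero.2 hne)
  have h2 : h x (v - w) = 0 := (map_sub (h x) v w).trans (sub_eq_zero.2 hvw)
  rw [h2] at h1
  exact lt_irrefl _ h1

/-- Raising the index in coordinates agrees with raising it on the manifold: both vectors have the
same image under `h`, which is injective by positivity. -/
lemma frame_inverse_formCoord (a : OneForm n M) {x₀ : M} {y : Coord n}
    (hy : y ∈ (extChartAt (𝓡 n) x₀).target) :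
    frame x₀ ((extChartAt (𝓡 n) x₀).symm y) ((bilinCoord h x₀ y).inverse (formCoord a x₀ y)) =
      sharp h a ((extChartAt (𝓡 n) x₀).symm y) := by
  have hq := (extChartAt (𝓡 n) x₀).map_target hy
  have e := (isInvertible_of_pos fun c hc => hh.bilinCoord_pos hy hc).self_apply_inverse
    (formCoord a x₀ y)
  refine hh.ext_of_apply ?_
  rw [hh.apply_sharp]
  refine ContinuousLinearMap.ext fun v => ?_
  have := congrArg (fun l => l (comps (n := n) x₀ _ v)) e
  rw [bilinCoord_apply, formCoord_apply, frame_comps hq] at this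
  exact this

lemma apply_sharp_eq (a b : OneForm n M) {x₀ : M} {y : Coord n}
    (hy : y ∈ (extChartAt (𝓡 n) x₀).target) :
    b ((extChartAt (𝓡 n) x₀).symm y) (sharp h a ((extChartAt (𝓡 n) x₀).symm y)) =
      formCoord b x₀ y ((bilinCoord h x₀ y).inverse (formCoord a x₀ y)) := by
  rw [formCoord_apply, hh.frame_inverse_formCoord a hy]

lemma continuousOn_inverse_bilinCoord (x₀ : M) :
    ContinuousOn (fun y => (bilinCoord h x₀ y).inverse) (extChartAt (𝓡 n) x₀).target := by
  intro y hy
  exact (contDiffAt_inverse_of_pos (k := 0) fun c hc =>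
    hh.bilinCoord_pos hy hc).continuousAt.comp_continuousWithinAt
      ((hh.contDiffOn x₀).continuousOn y hy)

lemma contDiffOn_dualCoord {a : OneForm n M} {x₀ : M}
    (ha : ContDiffOn ℝ 1 (formCoord a x₀) (extChartAt (𝓡 n) x₀).target) :
    ContDiffOn ℝ 1 (dualCoord h a x₀) (extChartAt (𝓡 n) x₀).target := by
  refine (hh.contDiffOn_density x₀).smul (ContDiffOn.clm_apply (fun y hy => ?_) ha)
  exact (contDiffAt_inverse_of_pos fun c hc => hh.bilinCoord_pos hy hc).comp_contDiffWithinAt y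
    (hh.contDiffOn x₀ y hy)

lemma continuousOn_divCoord {a : OneForm n M} {x₀ : M}
    (ha : ContDiffOn ℝ 1 (formCoord a x₀) (extChartAt (𝓡 n) x₀).target) :
    ContinuousOn (divCoord h a x₀) (extChartAt (𝓡 n) x₀).target := by
  have h1 := (hh.contDiffOn_dualCoord ha).continuousOn_fderiv_of_isOpen
    (isOpen_extChartAt_target x₀) le_rfl
  refine ((hh.continuousOn_density x₀).inv₀ fun y hy => (hh.density_pos hy).ne').mul ?_
  refine continuousOn_finsetSum _ fun i _ => ?_
  exact (EuclideanSpace.proj (𝕜 := ℝ) i).continuous.comp_continuousOn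
    (h1.clm_apply continuousOn_const)

lemma continuous_apply_sharp {a b : OneForm n M}
    (ha : ∀ x₀, ContinuousOn (formCoord a x₀) (extChartAt (𝓡 n) x₀).target)
    (hb : ∀ x₀, ContinuousOn (formCoord b x₀) (extChartAt (𝓡 n) x₀).target) :
    Continuous fun x => b x (sharp h a x) := by
  refine continuous_iff_continuousAt.2 fun x => ?_
  have h1 : ContinuousOn (fun y => formCoord b x y ((bilinCoord h x y).inverse (formCoord a x y)))
      (extChartAt (𝓡 n) x).target :=
    (hb x).clm_apply ((hh.continuousOn_inverse_bilinCoord x).clm_apply (ha x))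
  have h2 := (h1.continuousAt ((isOpen_extChartAt_target x).mem_nhds
    (mem_extChartAt_target x))).comp (continuousAt_extChartAt x)
  refine h2.congr ?_
  filter_upwards [extChartAt_source_mem_nhds (I := 𝓡 n) x] with q hq
  have h3 := hh.apply_sharp_eq a b ((extChartAt (𝓡 n) x).map_source hq)
  rw [(extChartAt (𝓡 n) x).left_inv hq] at h3
  exact h3.symm

end IsRiemannian

lemma dForm_eq_zero {f : M → ℝ} {x : M} (hx : x ∉ tsupport f) : dForm (n := n) f x = 0 := by
  have h1 : f =ᶠ[𝓝 x] fun _ => 0 := notMem_tsupport_iff_eventuallyEq.1 hx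
  exact h1.mfderiv_eq.trans mfderiv_const

/-! ### The divergence theorem -/

variable [MeasurableSpace M] [BorelSpace M] [T2Space M] [CompactSpace M]
  [SecondCountableTopology M]

/-- The divergence theorem for functions supported in a chart domain. -/
lemma integral_dForm_sharp_of_tsupport_subset {h : BilinField n M} (hh : IsRiemannian h)
    {a : OneForm n M} {x₀ : M}
    (ha : ContDiffOn ℝ 1 (formCoord a x₀) (extChartAt (𝓡 n) x₀).target)
    (ha' : ∀ x₁, ContinuousOn (formCoord a x₁) (extChartAt (𝓡 n) x₁).target)
    {f : M → ℝ} (hf : ContMDiff (𝓡 n) 𝓘(ℝ, ℝ) 1 f)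
    (hsupp : tsupport f ⊆ (extChartAt (𝓡 n) x₀).source) :
    ∫ x, dForm f x (sharp h a x) ∂(area h) =
      -∫ x, f x * divCoord h a x₀ (extChartAt (𝓡 n) x₀ x) ∂(area h) := by
  set φ := extChartAt (𝓡 n) x₀ with hφ
  have hT : IsOpen φ.target := isOpen_extChartAt_target x₀
  have hfz : ∀ x, x ∉ φ.source → f x = 0 := fun x hx =>
    image_eq_zero_of_notMem_tsupport fun h' => hx (hsupp h')
  -- the function in coordinates, extended by zero
  let u : Coord n → ℝ := φ.target.indicator fun y => f (φ.symm y)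
  let K : Set (Coord n) := φ '' tsupport f
  have hK : IsCompact K :=
    (isClosed_tsupport f).isCompact.image_of_continuousOn ((continuousOn_extChartAt x₀).mono hsupp)
  have hKT : K ⊆ φ.target := by
    rintro _ ⟨x, hx, rfl⟩
    exact φ.map_source (hsupp hx)
  have hu : ∀ y ∈ φ.target, u y = f (φ.symm y) := fun y hy => indicator_of_mem hy _
  have hu0 : ∀ y, y ∉ K → u y = 0 := by
    intro y hy
    by_cases hyT : y ∈ φ.target
    · rw [hu y hyT]
      refine image_eq_zero_of_notMem_tsupport fun h' => hy ⟨_, h', φ.right_inv hyT⟩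
    · exact indicator_of_notMem hyT _
  have hud : ∀ y ∈ φ.target, fderiv ℝ u y = formCoord (dForm f) x₀ y := by
    intro y hy
    rw [formCoord_dForm hf hy]
    refine Filter.EventuallyEq.fderiv_eq ?_
    filter_upwards [hT.mem_nhds hy] with z hz using hu z hz
  have hud0 : ∀ y, y ∉ K → fderiv ℝ u y = 0 := fun y hy => by
    have : u =ᶠ[𝓝 y] fun _ => 0 := by
      filter_upwards [hK.isClosed.isOpen_compl.mem_nhds hy] with z hz using hu0 z hz
    rw [this.fderiv_eq]; simp
  have huc : ContDiffOn ℝ 1 u φ.target :=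
    (ContMDiff.contDiffOn_localRep (k := 1) hf x₀).congr hu
  have hX := hh.contDiffOn_dualCoord ha
  have hXi : ∀ i, ContDiffOn ℝ 1 (fun y => dualCoord h a x₀ y i) φ.target := fun i =>
    (EuclideanSpace.proj (𝕜 := ℝ) i).contDiff.comp_contDiffOn hX
  have hXd : ∀ i, ∀ y ∈ φ.target, ∀ v, fderiv ℝ (fun y => dualCoord h a x₀ y i) y v =
      (fderiv ℝ (dualCoord h a x₀) y v) i := by
    intro i y hy v
    have h1 := ((hX.differentiableOn one_ne_zero).differentiableAt (hT.mem_nhds hy)).hasFDerivAt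
    have h2 := ((EuclideanSpace.proj (𝕜 := ℝ) i).hasFDerivAt (x := dualCoord h a x₀ y)).comp y h1
    exact congrArg (fun l => l v) h2.fderiv
  have hXc : ∀ i v, ContinuousOn (fun y => fderiv ℝ (fun y => dualCoord h a x₀ y i) y v) φ.target :=
    fun i v => ((hXi i).continuousOn_fderiv_of_isOpen hT le_rfl).clm_apply continuousOn_const
  have hudc : ∀ v, ContinuousOn (fun y => fderiv ℝ u y v) φ.target :=
    fun v => (huc.continuousOn_fderiv_of_isOpen hT le_rfl).clm_apply continuousOn_const
  -- both sides in coordinates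
  have hD : ContinuousOn (fun x => divCoord h a x₀ (φ x)) φ.source :=
    (hh.continuousOn_divCoord ha).comp (continuousOn_extChartAt x₀) fun x hx => φ.map_source hx
  have lhs : ∫ x, dForm f x (sharp h a x) ∂(area h) =
      ∫ y, ∑ i, fderiv ℝ u y (EuclideanSpace.single i 1) * dualCoord h a x₀ y i := by
    have hc : Continuous fun x => dForm f x (sharp h a x) :=
      hh.continuous_apply_sharp ha' (continuousOn_formCoord_dForm hf)
    have e1 : ∀ x, x ∉ φ.source → dForm f x (sharp h a x) = 0 := fun x hx => by
      rw [dForm_eq_zero fun h' => hx (hsupp h')]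
      rfl
    have e2 : ∀ y, y ∉ φ.target →
        ∑ i, fderiv ℝ u y (EuclideanSpace.single i 1) * dualCoord h a x₀ y i = 0 := fun y hy => by
      simp [hud0 y fun h' => hy (hKT h')]
    refine (setIntegral_eq_integral_of_forall_compl_eq_zero e1).symm.trans
      (((setIntegral_area hh x₀ hc.continuousOn).trans ?_).trans
        (setIntegral_eq_integral_of_forall_compl_eq_zero e2))
    refine setIntegral_congr_fun hT.measurableSet fun y hy => ?_
    have e : ∀ X : Coord n, X = ∑ i, X i • EuclideanSpace.single i (1 : ℝ) := fun X => by
      ext j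
      simp [Pi.single_apply]
    have e2 : formCoord (dForm f) x₀ y (dualCoord h a x₀ y) =
        ∑ i, dualCoord h a x₀ y i * formCoord (dForm f) x₀ y (EuclideanSpace.single i 1) := by
      conv_lhs => rw [e (dualCoord h a x₀ y)]
      rw [map_sum]
      simp only [map_smul, smul_eq_mul]
    simp only [hud y hy]
    rw [hh.apply_sharp_eq a (dForm f) hy]
    simp_rw [mul_comm _ (dualCoord h a x₀ y _)]
    rw [← e2, dualCoord, map_smul, smul_eq_mul]
  have rhs : ∫ x, f x * divCoord h a x₀ (φ x) ∂(area h) =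
      ∫ y, ∑ i, u y * fderiv ℝ (fun y => dualCoord h a x₀ y i) y (EuclideanSpace.single i 1) := by
    have e1 : ∀ x, x ∉ φ.source → f x * divCoord h a x₀ (φ x) = 0 := fun x hx => by
      rw [hfz x hx, zero_mul]
    have e2 : ∀ y, y ∉ φ.target → ∑ i, u y * fderiv ℝ (fun y => dualCoord h a x₀ y i) y
        (EuclideanSpace.single i 1) = 0 := fun y hy => by
      simp [hu0 y fun h' => hy (hKT h')]
    refine (setIntegral_eq_integral_of_forall_compl_eq_zero e1).symm.trans
      (((setIntegral_area hh x₀ (f := fun x => f x * divCoord h a x₀ (φ x))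
        (hf.continuous.continuousOn.mul hD)).trans ?_).trans
        (setIntegral_eq_integral_of_forall_compl_eq_zero e2))
    refine setIntegral_congr_fun hT.measurableSet fun y hy => ?_
    -- The density coming from `dA` cancels the inverse density in front of the coordinate
    -- divergence; on the other side of the identity it was absorbed into `dualCoord`.
    have := (hh.density_pos hy).ne'
    simp only [hXd _ y hy, hu y hy, ← Finset.mul_sum]
    rw [φ.right_inv hy, divCoord]
    field_simp
    exact mul_comm _ _
  rw [lhs, rhs, integral_finsetSum, integral_finsetSum, ← Finset.sum_neg_distrib]
  · refine Finset.sum_congr rfl fun i _ => ?_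
    rw [integral_mul_fderiv_eq_neg_of_eq_zero hT hK hKT huc (hXi i) hu0, neg_neg]
  · exact fun i _ => integrable_of_continuousOn_of_eq_zero hK hKT
      (huc.continuousOn.mul (hXc i _)) fun y hy => by rw [hu0 y hy, zero_mul]
  · exact fun i _ => integrable_of_continuousOn_of_eq_zero hK hKT
      ((hudc _).mul (hXi i).continuousOn) fun y hy => by rw [hud0 y hy]; simp

end Forms

/-! ### The global divergence theorem and the minimization problem for 1-forms. -/

section DivergenceTheorem

open Filter Topology

variable {n : ℕ} {M : Type*} [TopologicalSpace M] [ChartedSpace (Coord n) M]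
  [IsManifold (𝓡 n) ∞ M] [MeasurableSpace M] [BorelSpace M] [T2Space M] [CompactSpace M]
  [SecondCountableTopology M]

/-- A 1-form with continuously differentiable components. -/
def OneForm.IsC1 (a : OneForm n M) : Prop :=
  ∀ x₀, ContDiffOn ℝ 1 (formCoord a x₀) (extChartAt (𝓡 n) x₀).target

variable {h : BilinField n M} {a : OneForm n M}

lemma IsRiemannian.continuousOn_divCoord_extChartAt (hh : IsRiemannian h) (ha : a.IsC1) (x₀ : M) :
    ContinuousOn (fun x => divCoord h a x₀ (extChartAt (𝓡 n) x₀ x))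
      (extChartAt (𝓡 n) x₀).source :=
  (hh.continuousOn_divCoord (ha x₀)).comp (continuousOn_extChartAt x₀)
    fun _ hx => (extChartAt (𝓡 n) x₀).map_source hx

/-- The coordinate expressions of the divergence in two charts agree. -/
lemma divCoord_eq_divCoord (hh : IsRiemannian h) (ha : a.IsC1) {x₀ x₁ q : M}
    (h₀ : q ∈ (extChartAt (𝓡 n) x₀).source) (h₁ : q ∈ (extChartAt (𝓡 n) x₁).source) :
    divCoord h a x₀ (extChartAt (𝓡 n) x₀ q) = divCoord h a x₁ (extChartAt (𝓡 n) x₁ q) := by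
  have := isFiniteMeasure_area hh
  have := isOpenPosMeasure_area hh
  set U := (extChartAt (𝓡 n) x₀).source ∩ (extChartAt (𝓡 n) x₁).source with hUdef
  have hU : IsOpen U := (isOpen_extChartAt_source x₀).inter (isOpen_extChartAt_source x₁)
  set D₀ : M → ℝ := fun x => divCoord h a x₀ (extChartAt (𝓡 n) x₀ x)
  set D₁ : M → ℝ := fun x => divCoord h a x₁ (extChartAt (𝓡 n) x₁ x)
  have hD₀ : ContinuousOn D₀ U :=
    (hh.continuousOn_divCoord_extChartAt ha x₀).mono inter_subset_left
  have hD₁ : ContinuousOn D₁ U :=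
    (hh.continuousOn_divCoord_extChartAt ha x₁).mono inter_subset_right
  -- Instead of transforming the formula directly, both expressions are tested against smooth
  -- functions supported in the overlap. The one-chart divergence theorem gives the same,
  -- chart-independent, integral for both, so they agree almost everywhere, and by continuity
  -- everywhere on the overlap.
  have key : ∀ᵐ x ∂(area h), x ∈ U → (D₀ - D₁) x = 0 := by
    refine hU.ae_eq_zero_of_integral_contMDiff_smul_eq_zero (𝓡 n)
      ((hD₀.sub hD₁).locallyIntegrableOn hU.measurableSet) fun f hf hfc hfU => ?_
    have hf1 : ContMDiff (𝓡 n) 𝓘(ℝ, ℝ) 1 f := hf.of_le (by exact_mod_cast le_top)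
    have e₀ := integral_dForm_sharp_of_tsupport_subset hh (ha x₀) (fun x => (ha x).continuousOn)
      hf1 (hfU.trans inter_subset_left)
    have e₁ := integral_dForm_sharp_of_tsupport_subset hh (ha x₁) (fun x => (ha x).continuousOn)
      hf1 (hfU.trans inter_subset_right)
    have i₀ : Integrable (fun x => f x * D₀ x) (area h) :=
      integrable_of_continuousOn_of_eq_zero hfc hfU (hf.continuous.continuousOn.mul hD₀)
        fun x hx => by rw [image_eq_zero_of_notMem_tsupport hx, zero_mul]
    have i₁ : Integrable (fun x => f x * D₁ x) (area h) :=
      integrable_of_continuousOn_of_eq_zero hfc hfU (hf.continuous.continuousOn.mul hD₁)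
        fun x hx => by rw [image_eq_zero_of_notMem_tsupport hx, zero_mul]
    simp only [Pi.sub_apply, smul_eq_mul, mul_sub]
    rw [integral_sub i₀ i₁]
    linarith
  have hae : D₀ =ᵐ[(area h).restrict U] D₁ := by
    rw [Filter.EventuallyEq, ae_restrict_iff' hU.measurableSet]
    filter_upwards [key] with x hx hxU
    exact sub_eq_zero.1 (hx hxU)
  exact Measure.eqOn_open_of_ae_eq hae hU hD₀ hD₁ ⟨h₀, h₁⟩

lemma divergence_eq_divCoord_of_mem (hh : IsRiemannian h) (ha : a.IsC1) {x₀ q : M}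
    (hq : q ∈ (extChartAt (𝓡 n) x₀).source) :
    divergence h a q = divCoord h a x₀ (extChartAt (𝓡 n) x₀ q) :=
  divCoord_eq_divCoord hh ha (mem_extChartAt_source q) hq

lemma continuous_divergence (hh : IsRiemannian h) (ha : a.IsC1) : Continuous (divergence h a) := by
  refine continuous_iff_continuousAt.2 fun x => ?_
  have hx := extChartAt_source_mem_nhds (I := 𝓡 n) x
  refine ((hh.continuousOn_divCoord_extChartAt ha x).continuousAt hx).congr ?_
  filter_upwards [hx] with q hq using (divergence_eq_divCoord_of_mem hh ha hq).symm

lemma continuous_dForm_sharp (hh : IsRiemannian h) (ha : a.IsC1) {f : M → ℝ}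
    (hf : ContMDiff (𝓡 n) 𝓘(ℝ, ℝ) 1 f) : Continuous fun x => dForm f x (sharp h a x) :=
  hh.continuous_apply_sharp (fun x => (ha x).continuousOn) (continuousOn_formCoord_dForm hf)

lemma integrable_of_continuous (hh : IsRiemannian h) {f : M → ℝ} (hf : Continuous f) :
    Integrable f (area h) := by
  have := isFiniteMeasure_area hh
  exact integrable_of_continuousOn_of_eq_zero isCompact_univ subset_rfl hf.continuousOn
    fun x hx => absurd (mem_univ x) hx

lemma dForm_add {f f' : M → ℝ} (hf : ContMDiff (𝓡 n) 𝓘(ℝ, ℝ) 1 f)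
    (hf' : ContMDiff (𝓡 n) 𝓘(ℝ, ℝ) 1 f') (x : M) :
    dForm (n := n) (f + f') x = dForm f x + dForm f' x :=
  mfderiv_add ((hf x).mdifferentiableAt one_ne_zero) ((hf' x).mdifferentiableAt one_ne_zero)

/-- The divergence theorem on a closed Riemannian manifold. -/
theorem integral_dForm_sharp (hh : IsRiemannian h) (ha : a.IsC1) {f : M → ℝ}
    (hf : ContMDiff (𝓡 n) 𝓘(ℝ, ℝ) ∞ f) :
    ∫ x, dForm f x (sharp h a x) ∂(area h) = -∫ x, f x * divergence h a x ∂(area h) := by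
  obtain ⟨t, ht⟩ := isCompact_univ.elim_finite_subcover
    (fun x : M => (extChartAt (𝓡 n) x).source) (fun x => isOpen_extChartAt_source x)
    fun x _ => mem_iUnion.2 ⟨x, mem_extChartAt_source x⟩
  obtain ⟨ρ, hρ⟩ := SmoothPartitionOfUnity.exists_isSubordinate (𝓡 n) isClosed_univ
    (fun x : t => (extChartAt (𝓡 n) (x : M)).source) (fun x => isOpen_extChartAt_source _)
    (fun x hx => by simpa using ht hx)
  -- The regularity is carried inside `P` because the additivity of `dForm` and of the integrals
  -- requires it at every stage of the induction over the partition of unity.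
  let P : (M → ℝ) → Prop := fun f => ContMDiff (𝓡 n) 𝓘(ℝ, ℝ) 1 f ∧
    ∫ x, dForm f x (sharp h a x) ∂(area h) = -∫ x, f x * divergence h a x ∂(area h)
  have hadd : ∀ f f', P f → P f' → P (f + f') := by
    rintro f f' ⟨hf, e⟩ ⟨hf', e'⟩
    refine ⟨hf.add hf', ?_⟩
    have l1 : ∀ x, dForm (f + f') x (sharp h a x) =
        dForm f x (sharp h a x) + dForm f' x (sharp h a x) := fun x => by
      rw [dForm_add hf hf']; rfl
    simp only [l1, Pi.add_apply, add_mul]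
    have hc := continuous_divergence hh ha
    rw [integral_add (integrable_of_continuous hh (continuous_dForm_sharp hh ha hf))
      (integrable_of_continuous hh (continuous_dForm_sharp hh ha hf')),
      integral_add (f := fun x => f x * divergence h a x) (g := fun x => f' x * divergence h a x)
      (integrable_of_continuous hh (hf.continuous.mul hc))
      (integrable_of_continuous hh (hf'.continuous.mul hc)), e, e']
    ring
  have hzero : P 0 := by
    refine ⟨contMDiff_const, ?_⟩
    have : ∀ x, dForm (n := n) (0 : M → ℝ) x = 0 := fun x => mfderiv_const
    simp [this]
  have hpart : ∀ i ∈ (Finset.univ : Finset t), P (fun x => ρ i x * f x) := by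
    intro i _
    have hs : tsupport (fun x => ρ i x * f x) ⊆ (extChartAt (𝓡 n) (i : M)).source :=
      (tsupport_mul_subset_left).trans (hρ i)
    have hsm : ContMDiff (𝓡 n) 𝓘(ℝ, ℝ) 1 (fun x => ρ i x * f x) :=
      ((ρ i).contMDiff.mul hf).of_le (by exact_mod_cast le_top)
    refine ⟨hsm, ?_⟩
    rw [integral_dForm_sharp_of_tsupport_subset hh (ha i) (fun x => (ha x).continuousOn) hsm hs]
    congr 1
    refine integral_congr_ae (ae_of_all _ fun x => ?_)
    by_cases hx : x ∈ (extChartAt (𝓡 n) (i : M)).source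
    · simp only [divergence_eq_divCoord_of_mem hh ha hx]
    · have h0 : ρ i x * f x = 0 := image_eq_zero_of_notMem_tsupport
        (f := fun x => ρ i x * f x) fun h' => hx (hs h')
      simp only [h0, zero_mul]
  have hsum := Finset.sum_induction (fun (i : t) (x : M) => ρ i x * f x) P hadd hzero hpart
  have hfe : (∑ i : t, fun x : M => ρ i x * f x) = f := by
    ext x
    have h1 := ρ.sum_eq_one (mem_univ x)
    rw [finsum_eq_sum_of_fintype] at h1
    rw [Finset.sum_apply, ← Finset.sum_mul, h1, one_mul]
  rw [hfe] at hsum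
  exact hsum.2

/-! ### The energy of a 1-form under addition of exact forms -/

lemma IsRiemannian.apply_sharp_symm (hh : IsRiemannian h) (a b : OneForm n M) (x : M) :
    a x (sharp h b x) = b x (sharp h a x) := by
  rw [← hh.apply_sharp a x, ← hh.apply_sharp b x, hh.symm]

lemma normSq_sub (hh : IsRiemannian h) (a b : OneForm n M) (x : M) :
    normSq h (a - b) x = normSq h a x - 2 * b x (sharp h a x) + normSq h b x := by
  have h1 : sharp h (a - b) x = sharp h a x - sharp h b x := map_sub ((h x).inverse) (a x) (b x)
  have h2 : ∀ v, (a - b) x v = a x v - b x v := fun v => rfl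
  simp only [normSq]
  rw [h1, h2, map_sub, map_sub, hh.apply_sharp_symm a b]
  ring

lemma normSq_nonneg (hh : IsRiemannian h) (a : OneForm n M) (x : M) : 0 ≤ normSq h a x := by
  rw [normSq, ← hh.apply_sharp a x]
  by_cases h0 : sharp h a x = 0
  · rw [h0]; simp
  · rw [hh.apply_sharp a x]
    have := hh.pos x _ h0
    rw [hh.apply_sharp a x] at this
    exact this.le

lemma dForm_smul {f : M → ℝ} (t : ℝ) (hf : ContMDiff (𝓡 n) 𝓘(ℝ, ℝ) 1 f) (x : M) :
    dForm (n := n) (t • f) x = t • dForm f x :=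
  const_smul_mfderiv ((hf x).mdifferentiableAt one_ne_zero) t

/-- The cross term of the expanded square is `-2∫ df(a^♯)`, which the divergence theorem turns into
`2∫ f div a`. -/
lemma integral_normSq_sub_dForm (hh : IsRiemannian h) (ha : a.IsC1) {f : M → ℝ}
    (hf : ContMDiff (𝓡 n) 𝓘(ℝ, ℝ) ∞ f) :
    ∫ x, normSq h (a - dForm f) x ∂(area h) = ∫ x, normSq h a x ∂(area h) +
      2 * ∫ x, f x * divergence h a x ∂(area h) + ∫ x, normSq h (dForm f) x ∂(area h) := by
  have hf1 : ContMDiff (𝓡 n) 𝓘(ℝ, ℝ) 1 f := hf.of_le (by exact_mod_cast le_top)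
  have ha0 := fun x => (ha x).continuousOn
  have hdf := continuousOn_formCoord_dForm hf1
  have i1 : Integrable (fun x => normSq h a x) (area h) :=
    integrable_of_continuous hh (hh.continuous_apply_sharp ha0 ha0)
  have i2 : Integrable (fun x => 2 * dForm f x (sharp h a x)) (area h) :=
    (integrable_of_continuous hh (continuous_dForm_sharp hh ha hf1)).const_mul 2
  have i3 : Integrable (fun x => normSq h (dForm f) x) (area h) :=
    integrable_of_continuous hh (hh.continuous_apply_sharp hdf hdf)
  simp only [normSq_sub hh]
  rw [integral_add (f := fun x => normSq h a x - 2 * dForm f x (sharp h a x)) (i1.sub i2) i3,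
    integral_sub i1 i2, integral_const_mul,
    integral_dForm_sharp hh ha hf]
  ring

/-- A 1-form has least energy among those differing from it by an exact form if and only if it is
divergence free. -/
theorem forall_integral_normSq_le_iff (hh : IsRiemannian h) (ha : a.IsC1) :
    (∀ f : M → ℝ, ContMDiff (𝓡 n) 𝓘(ℝ, ℝ) ∞ f →
      ∫ x, normSq h a x ∂(area h) ≤ ∫ x, normSq h (a - dForm f) x ∂(area h)) ↔
      ∀ x, divergence h a x = 0 := by
  have hc := continuous_divergence hh ha
  constructor
  · intro hmin
    have := isFiniteMeasure_area hh
    have := isOpenPosMeasure_area hh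
    have key : ∀ f : M → ℝ, ContMDiff (𝓡 n) 𝓘(ℝ, ℝ) ∞ f →
        ∫ x, f x * divergence h a x ∂(area h) = 0 := by
      intro f hf
      have hf1 : ContMDiff (𝓡 n) 𝓘(ℝ, ℝ) 1 f := hf.of_le (by exact_mod_cast le_top)
      set I := ∫ x, f x * divergence h a x ∂(area h) with hI
      set Q := ∫ x, normSq h (dForm f) x ∂(area h) with hQ
      have hQ0 : 0 ≤ Q := integral_nonneg fun x => normSq_nonneg hh _ x
      -- Minimality along the line `t ↦ a - t df`; a quadratic in `t` vanishing at `0` can be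
      -- nonnegative everywhere only if its linear coefficient is zero.
      have ineq : ∀ t : ℝ, 0 ≤ 2 * (t * I) + t ^ 2 * Q := by
        intro t
        have htf : ContMDiff (𝓡 n) 𝓘(ℝ, ℝ) ∞ (t • f) :=
          (contDiff_const_smul t).contMDiff.comp hf
        have h1 := hmin (t • f) htf
        rw [integral_normSq_sub_dForm hh ha htf] at h1
        have h2 : ∫ x, (t • f) x * divergence h a x ∂(area h) = t * I := by
          rw [hI, ← integral_const_mul]
          simp only [Pi.smul_apply, smul_eq_mul, mul_assoc]
        have h3 : ∫ x, normSq h (dForm (t • f)) x ∂(area h) = t ^ 2 * Q := by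
          rw [hQ, ← integral_const_mul]
          refine integral_congr_ae (ae_of_all _ fun x => ?_)
          have e : sharp h (dForm (t • f)) x = t • sharp h (dForm f) x := by
            rw [sharp, dForm_smul t hf1]
            exact map_smul (h x).inverse t _
          simp only [normSq]
          rw [e, dForm_smul t hf1]
          change t * (dForm f x (t • _)) = _
          rw [map_smul, smul_eq_mul]
          ring
        rw [h2, h3] at h1
        linarith
      by_contra hne
      -- The minimum of the quadratic is at `-I / Q`; the shifted denominator avoids the case `Q =
      -- 0` and still gives a negative value when `I ≠ 0`.
      have h4 := ineq (-I / (Q + 1))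
      have hQ1 : 0 < Q + 1 := by linarith
      have h5 : 2 * (-I / (Q + 1) * I) + (-I / (Q + 1)) ^ 2 * Q =
          -(I ^ 2 * (Q + 2)) / (Q + 1) ^ 2 := by
        field_simp
        ring
      rw [h5] at h4
      have h6 : 0 < I ^ 2 * (Q + 2) / (Q + 1) ^ 2 := by positivity
      rw [neg_div] at h4
      linarith
    -- The fundamental lemma of the calculus of variations; continuity of the divergence removes the
    -- exceptional null set.
    have hae : ∀ᵐ x ∂(area h), divergence h a x = 0 :=
      ae_eq_zero_of_integral_contMDiff_smul_eq_zero (𝓡 n) hc.locallyIntegrable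
        fun f hf _ => key f hf
    have := Continuous.ae_eq_iff_eq (area h) hc (continuous_const (y := (0 : ℝ))) |>.1 hae
    exact fun x => congrFun this x
  · intro hdiv f hf
    rw [integral_normSq_sub_dForm hh ha hf]
    have h1 : 0 ≤ ∫ x, normSq h (dForm f) x ∂(area h) :=
      integral_nonneg fun x => normSq_nonneg hh _ x
    simp only [hdiv, mul_zero, integral_zero]
    linarith

end DivergenceTheorem

/-! ### The transformation law of the Christoffel symbols -/

section Christoffel

variable {D E F : Type*} [NormedAddCommGroup D] [NormedSpace ℝ D] [NormedAddCommGroup E]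
  [NormedSpace ℝ E] [NormedAddCommGroup F] [NormedSpace ℝ F]

lemma fderiv_bilin_apply {G : D → E →L[ℝ] F →L[ℝ] ℝ} {V : D → E} {W : D → F} {x : D}
    (hG : DifferentiableAt ℝ G x) (hV : DifferentiableAt ℝ V x) (hW : DifferentiableAt ℝ W x)
    (u : D) :
    fderiv ℝ (fun x => G x (V x) (W x)) x u =
      fderiv ℝ G x u (V x) (W x) + G x (fderiv ℝ V x u) (W x) + G x (V x) (fderiv ℝ W x u) := by
  rw [((hG.hasFDerivAt.clm_apply hV.hasFDerivAt).clm_apply hW.hasFDerivAt).fderiv]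
  simp only [add_apply, ContinuousLinearMap.comp_apply,
    ContinuousLinearMap.flip_apply]
  ring

lemma fderiv_comp_apply {G : E → F} {τ : D → E} {y : D} (hG : DifferentiableAt ℝ G (τ y))
    (hτ : DifferentiableAt ℝ τ y) (u : D) :
    fderiv ℝ (fun z => G (τ z)) y u = fderiv ℝ G (τ y) (fderiv ℝ τ y u) :=
  congrArg (fun l => l u) (hG.hasFDerivAt.comp y hτ.hasFDerivAt).fderiv

lemma differentiableAt_comp_fun {G : E → F} {τ : D → E} {y : D} (hG : DifferentiableAt ℝ G (τ y))
    (hτ : DifferentiableAt ℝ τ y) : DifferentiableAt ℝ (fun z => G (τ z)) y :=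
  hG.comp y hτ

/-- The Christoffel symbols of the first kind, as a function of the derivative of the metric. -/
def christoffelForm (B : E →L[ℝ] E →L[ℝ] E →L[ℝ] ℝ) (v u w : E) : ℝ :=
  1 / 2 * (B u v w + B v u w - B w v u)

-- The product rule for `G(τ)(dτ v, dτ w)`: one term from differentiating the metric and two
-- involving the second derivative of the coordinate change.
set_option synthInstance.maxHeartbeats 200000 in
lemma fderiv_pullbackForm_apply {G : E → E →L[ℝ] E →L[ℝ] ℝ} {τ : E → E} {y : E}
    {G₀ : E → E →L[ℝ] E →L[ℝ] ℝ}
    (hG₀ : DifferentiableAt ℝ G₀ y) (hG : DifferentiableAt ℝ G (τ y)) (hτ : ContDiffAt ℝ 2 τ y)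
    (h : ∀ᶠ z in nhds y, G₀ z = pullbackForm (G (τ z)) (fderiv ℝ τ z)) (u v w : E) :
    fderiv ℝ G₀ y u v w =
      fderiv ℝ G (τ y) (fderiv ℝ τ y u) (fderiv ℝ τ y v) (fderiv ℝ τ y w) +
        G (τ y) (fderiv ℝ (fderiv ℝ τ) y u v) (fderiv ℝ τ y w) +
        G (τ y) (fderiv ℝ τ y v) (fderiv ℝ (fderiv ℝ τ) y u w) := by
  have hτ1 : DifferentiableAt ℝ τ y := hτ.differentiableAt two_ne_zero
  have hτ2 : DifferentiableAt ℝ (fderiv ℝ τ) y :=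
    (hτ.fderiv_right (m := 1) (by norm_num)).differentiableAt one_ne_zero
  have hc : ∀ v : E, DifferentiableAt ℝ (fun z => fderiv ℝ τ z v) y := fun v =>
    hτ2.clm_apply (differentiableAt_const v)
  have hcd : ∀ v : E, fderiv ℝ (fun z => fderiv ℝ τ z v) y u = fderiv ℝ (fderiv ℝ τ) y u v :=
    fun v => by
      rw [(hτ2.hasFDerivAt.clm_apply (hasFDerivAt_const v y)).fderiv]
      simp
  have e1 : fderiv ℝ G₀ y u v w = fderiv ℝ (fun z => G₀ z v w) y u := by
    have := fderiv_bilin_apply hG₀ (differentiableAt_const v) (differentiableAt_const w) u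
    simp only [fderiv_fun_const, Pi.zero_apply, zero_apply, map_zero, add_zero] at this
    exact this.symm
  have e2 : (fun z => G₀ z v w) =ᶠ[nhds y] fun z => G (τ z) (fderiv ℝ τ z v) (fderiv ℝ τ z w) := by
    filter_upwards [h] with z hz
    rw [hz, pullbackForm_apply]
  have hc0 : DifferentiableAt ℝ (fun z => G (τ z)) y :=
    differentiableAt_comp_fun (F := E →L[ℝ] E →L[ℝ] ℝ) (G := G) (τ := τ) hG hτ1
  have e3 := fderiv_bilin_apply (G := fun z => G (τ z)) hc0 (hc v) (hc w) u
  have e4 := fderiv_comp_apply (F := E →L[ℝ] E →L[ℝ] ℝ) (G := G) (τ := τ) hG hτ1 u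
  rw [e4, hcd, hcd] at e3
  rw [e1, e2.fderiv_eq, e3]

-- Of the six second-derivative terms in the alternating sum, four cancel in pairs by symmetry of
-- the second derivative and of the metric; the remaining two coincide and give the inhomogeneous
-- term.
set_option synthInstance.maxHeartbeats 200000 in
lemma christoffelForm_pullbackForm {G : E → E →L[ℝ] E →L[ℝ] ℝ} {τ : E → E} {y : E}
    {G₀ : E → E →L[ℝ] E →L[ℝ] ℝ}
    (hG₀ : DifferentiableAt ℝ G₀ y) (hG : DifferentiableAt ℝ G (τ y)) (hτ : ContDiffAt ℝ 2 τ y)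
    (hsymm : ∀ v w, G (τ y) v w = G (τ y) w v)
    (h : ∀ᶠ z in nhds y, G₀ z = pullbackForm (G (τ z)) (fderiv ℝ τ z)) (v u w : E) :
    christoffelForm (fderiv ℝ G₀ y) v u w =
      christoffelForm (fderiv ℝ G (τ y)) (fderiv ℝ τ y v) (fderiv ℝ τ y u) (fderiv ℝ τ y w) +
        G (τ y) (fderiv ℝ (fderiv ℝ τ) y u v) (fderiv ℝ τ y w) := by
  have hs : ∀ a b, fderiv ℝ (fderiv ℝ τ) y a b = fderiv ℝ (fderiv ℝ τ) y b a :=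
    hτ.isSymmSndFDerivAt (by simp)
  simp only [christoffelForm, fderiv_pullbackForm_apply hG₀ hG hτ h]
  rw [hs v u, hs w u, hs w v, hsymm (fderiv ℝ τ y v), hsymm (fderiv ℝ τ y u)]
  ring

end Christoffel

/-! ### The spacetime metric, the surface and fields along it in coordinates. -/

section LocalRepresentatives

variable {N : Type*} [TopologicalSpace N] [ChartedSpace (Coord 4) N] [IsManifold (𝓡 4) ∞ N]
  {S : Type*} [TopologicalSpace S] [ChartedSpace (Coord 2) S] [IsManifold (𝓡 2) ∞ S]

/-- The components of the metric are its values on coordinate fields, and these are smooth sections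
because they are constant in the trivialization. -/
lemma LorentzMetric.contDiffOn_bilinCoord (g : LorentzMetric N) (z₀ : N) :
    ContDiffOn ℝ ∞ (bilinCoord g.val z₀) (extChartAt (𝓡 4) z₀).target := by
  have hfr : ∀ c : Coord 4, ContMDiffOn (𝓡 4) (𝓡 4).tangent ∞
      (fun x => (⟨x, frame z₀ x c⟩ : TangentBundle (𝓡 4) N)) (extChartAt (𝓡 4) z₀).source := by
    intro c
    have hmem : ∀ x ∈ (extChartAt (𝓡 4) z₀).source,
        x ∈ (trivializationAt (Coord 4) (TangentSpace (𝓡 4)) z₀).baseSet := fun x hx => by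
      simpa [extChartAt_source] using hx
    refine ((trivializationAt (Coord 4) (TangentSpace (𝓡 4)) z₀).contMDiffOn_iff
      fun x hx => ?_).2 ⟨contMDiffOn_id, ?_⟩
    · exact (Trivialization.mem_source _).2 (hmem x hx)
    · refine (contMDiffOn_const (c := c)).congr fun x hx => ?_
      have h1 := comps_frame hx c
      have h2 : comps z₀ x (frame z₀ x c) =
        (trivializationAt (Coord 4) (TangentSpace (𝓡 4)) z₀ ⟨x, frame z₀ x c⟩).2 :=
        congrFun ((trivializationAt (Coord 4) (TangentSpace (𝓡 4)) z₀).coe_linearMapAt_of_mem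
          (R := ℝ) (hmem x hx)) _
      exact h2.symm.trans h1
  refine contDiffOn_clm_apply.2 fun c => contDiffOn_clm_apply.2 fun d => ?_
  have h1 : ContMDiffOn (𝓡 4) 𝓘(ℝ, ℝ) ∞ (fun x => g.val x (frame z₀ x c) (frame z₀ x d))
      (extChartAt (𝓡 4) z₀).source := by
    have h2 := ContMDiffOn.clm_bundle_apply₂ (F₁ := Coord 4) (F₂ := Coord 4) (F₃ := ℝ)
      (E₃ := Bundle.Trivial N ℝ) g.smooth.contMDiffOn (hfr c) (hfr d)
    intro x hx
    have h3 := h2 x hx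
    simp only [contMDiffWithinAt_totalSpace] at h3
    exact h3.2
  rw [← contMDiffOn_iff_contDiffOn]
  exact h1.comp (contMDiffOn_extChartAt_symm z₀) fun y hy => (extChartAt (𝓡 4) z₀).map_target hy

/-- The map `Φ` in the charts around `p₀` and `z₀`. -/
abbrev surfCoord (Φ : S → N) (p₀ : S) (z₀ : N) : Coord 2 → Coord 4 :=
  mapCoord (n := 2) (m := 4) Φ p₀ z₀

/-- The domain of `surfCoord`. -/
abbrev surfDomain (Φ : S → N) (p₀ : S) (z₀ : N) : Set (Coord 2) :=
  mapDomain (n := 2) (m := 4) Φ p₀ z₀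

/-- The components of a vector field along `Φ` in the charts around `p₀` and `z₀`. -/
def fieldCoord {Φ : S → N} (V : FieldAlong Φ) (p₀ : S) (z₀ : N) (y : Coord 2) : Coord 4 :=
  comps z₀ (Φ ((extChartAt (𝓡 2) p₀).symm y)) (V ((extChartAt (𝓡 2) p₀).symm y))

lemma trivializationAt_snd {z₀ x : N} (hx : x ∈ (extChartAt (𝓡 4) z₀).source)
    (v : TangentSpace (𝓡 4) x) :
    (trivializationAt (Coord 4) (TangentSpace (𝓡 4)) z₀ ⟨x, v⟩).2 = comps z₀ x v := by
  have hmem : x ∈ (trivializationAt (Coord 4) (TangentSpace (𝓡 4)) z₀).baseSet := by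
    simpa [extChartAt_source] using hx
  exact (congrFun ((trivializationAt (Coord 4) (TangentSpace (𝓡 4)) z₀).coe_linearMapAt_of_mem
    (R := ℝ) hmem) v).symm

variable {Φ : S → N}

lemma FieldAlong.Smooth.contDiffOn_fieldCoord {V : FieldAlong Φ} (hV : V.Smooth) (p₀ : S) (z₀ : N) :
    ContDiffOn ℝ ∞ (fieldCoord V p₀ z₀) (surfDomain Φ p₀ z₀) := by
  have h1 : ContMDiffOn 𝓘(ℝ, Coord 2) (𝓡 4).tangent ∞
      (fun y => (⟨Φ ((extChartAt (𝓡 2) p₀).symm y), V ((extChartAt (𝓡 2) p₀).symm y)⟩ :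
        TangentBundle (𝓡 4) N)) (surfDomain Φ p₀ z₀) :=
    ContMDiff.comp_contMDiffOn (f := (extChartAt (𝓡 2) p₀).symm) hV
      ((contMDiffOn_extChartAt_symm p₀).mono inter_subset_left)
  rw [← contMDiffOn_iff_contDiffOn]
  have h2 := (((trivializationAt (Coord 4) (TangentSpace (𝓡 4)) z₀).contMDiffOn_iff
      fun y hy => ?_).1 h1).2
  · exact h2.congr fun y hy => (trivializationAt_snd hy.2 _).symm
  · refine (Trivialization.mem_source _).2 ?_
    simpa [extChartAt_source] using hy.2

lemma FieldAlong.smooth_of_fieldCoord (hΦ : ContMDiff (𝓡 2) (𝓡 4) ∞ Φ) {V : FieldAlong Φ}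
    (hV : ∀ p, ContDiffAt ℝ ∞ (fieldCoord V p (Φ p)) (extChartAt (𝓡 2) p p)) : V.Smooth := by
  intro p
  refine contMDiffAt_totalSpace.2 ⟨hΦ p, ?_⟩
  have h1 : ContMDiffAt (𝓡 2) 𝓘(ℝ, Coord 4) ∞ (fun q => comps (Φ p) (Φ q) (V q)) p :=
    contMDiffAt_of_localRep (k := ⊤) (hV p)
  refine h1.congr_of_eventuallyEq ?_
  filter_upwards [hΦ.continuous.continuousAt.preimage_mem_nhds
    (extChartAt_source_mem_nhds (I := 𝓡 4) (Φ p))] with q hq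
  exact trivializationAt_snd hq _

lemma metric_apply_eq (g : LorentzMetric N) {p₀ : S} {z₀ : N} {y : Coord 2}
    (hy : y ∈ surfDomain Φ p₀ z₀) (v w : TangentSpace (𝓡 4) (Φ ((extChartAt (𝓡 2) p₀).symm y))) :
    g.val (Φ ((extChartAt (𝓡 2) p₀).symm y)) v w =
      bilinCoord g.val z₀ (surfCoord Φ p₀ z₀ y) (comps z₀ _ v) (comps z₀ _ w) := by
  rw [bilinCoord_apply]
  have e : (extChartAt (𝓡 4) z₀).symm (surfCoord Φ p₀ z₀ y) = Φ ((extChartAt (𝓡 2) p₀).symm y) :=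
    (extChartAt (𝓡 4) z₀).left_inv hy.2
  rw [e, frame_comps hy.2, frame_comps hy.2]

lemma comps_differential_frame (hΦ : ContMDiff (𝓡 2) (𝓡 4) ∞ Φ) {p₀ : S} {z₀ : N} {y : Coord 2}
    (hy : y ∈ surfDomain Φ p₀ z₀) (c : Coord 2) :
    comps z₀ _ (differential Φ _ (frame p₀ ((extChartAt (𝓡 2) p₀).symm y) c)) =
      fderiv ℝ (surfCoord Φ p₀ z₀) y c := by
  rw [(MDifferentiableAt.hasFDerivAt_mapCoord hy
    ((hΦ _).mdifferentiableAt (by simp))).fderiv]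
  rfl

lemma bilinCoord_induced (g : LorentzMetric N) (hΦ : ContMDiff (𝓡 2) (𝓡 4) ∞ Φ) {p₀ : S} {z₀ : N}
    {y : Coord 2} (hy : y ∈ surfDomain Φ p₀ z₀) :
    bilinCoord (induced g Φ) p₀ y =
      pullbackForm (bilinCoord g.val z₀ (surfCoord Φ p₀ z₀ y)) (fderiv ℝ (surfCoord Φ p₀ z₀) y) := by
  ext c d
  rw [pullbackForm_apply, ← comps_differential_frame hΦ hy, ← comps_differential_frame hΦ hy,
    ← metric_apply_eq g hy]
  rfl

end LocalRepresentatives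

/-! ### The covariant derivative along the surface in an arbitrary chart. -/

section CovariantDerivative

open Filter Topology

variable {N : Type*} [TopologicalSpace N] [ChartedSpace (Coord 4) N] [IsManifold (𝓡 4) ∞ N]
  {S : Type*} [TopologicalSpace S] [ChartedSpace (Coord 2) S] [IsManifold (𝓡 2) ∞ S]
  {Φ : S → N} {g : LorentzMetric N}

lemma comps_eq_fderiv_transition {n : ℕ} {M : Type*} [TopologicalSpace M]
    [ChartedSpace (Coord n) M] [IsManifold (𝓡 n) ∞ M] {z₀ z₁ x : M}
    (h₀ : x ∈ (extChartAt (𝓡 n) z₀).source) (h₁ : x ∈ (extChartAt (𝓡 n) z₁).source)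
    (v : TangentSpace (𝓡 n) x) :
    comps (n := n) z₁ x v =
      fderiv ℝ (transition z₀ z₁) (extChartAt (𝓡 n) z₀ x) (comps (n := n) z₀ x v) := by
  have hx : (extChartAt (𝓡 n) z₀).symm (extChartAt (𝓡 n) z₀ x) = x :=
    (extChartAt (𝓡 n) z₀).left_inv h₀
  have hy : extChartAt (𝓡 n) z₀ x ∈ overlap (n := n) z₀ z₁ := by
    refine ⟨(extChartAt (𝓡 n) z₀).map_source h₀, ?_⟩
    rw [mem_preimage, hx]
    exact h₁
  have h := frame_eq_frame_comp_fderiv hy (comps (n := n) z₀ x v)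
  rw [hx, frame_comps h₀] at h
  conv_lhs => rw [h]
  exact comps_frame h₁ _

/-- The Lorentzian metric is indefinite, so invertibility comes from nondegeneracy and not from
positivity. This makes `inverse` in the definition of `christoffel` a true inverse. -/
lemma bilinCoord_center_apply_inverse (g : LorentzMetric N) (z : N) (l : Coord 4 →L[ℝ] ℝ) :
    bilinCoord g.val z (extChartAt (𝓡 4) z z)
      ((bilinCoord g.val z (extChartAt (𝓡 4) z z)).inverse l) = l := by
  refine bilin_apply_inverse _ (fun X hX => ?_) l
  have hz : (extChartAt (𝓡 4) z).symm (extChartAt (𝓡 4) z z) ∈ (extChartAt (𝓡 4) z).source :=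
    (extChartAt (𝓡 4) z).map_target (mem_extChartAt_target z)
  have h0 := nondegenerate g _ (frame z ((extChartAt (𝓡 4) z).symm (extChartAt (𝓡 4) z z)) X)
      fun w => by
    have := congrArg (fun l : Coord 4 →L[ℝ] ℝ => l (comps (n := 4) z _ w)) hX
    rw [bilinCoord_apply, frame_comps hz] at this
    exact this
  have := comps_frame hz X
  exact this.symm.trans ((congrArg (comps (n := 4) z _) h0).trans (map_zero _))

lemma LorentzMetric.bilinCoord_symm (g : LorentzMetric N) (z : N) (y v w : Coord 4) :
    bilinCoord g.val z y v w = bilinCoord g.val z y w v := g.symm _ _ _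

lemma FieldAlong.Smooth.mdifferentiableAt_comps {V : FieldAlong Φ} (hV : V.Smooth) (q : S) :
    MDifferentiableAt (𝓡 2) 𝓘(ℝ, Coord 4) (fun p => comps (Φ q) (Φ p) (V p)) q := by
  obtain ⟨h1, h2⟩ := contMDiffAt_totalSpace.1 (hV q)
  refine (h2.congr_of_eventuallyEq ?_).mdifferentiableAt (by simp)
  filter_upwards [h1.continuousAt.preimage_mem_nhds
    (extChartAt_source_mem_nhds (I := 𝓡 4) (Φ q))] with p hp
  exact (trivializationAt_snd hp _).symm

lemma surfCoord_mem_target {p₀ : S} {z₀ : N} {y : Coord 2} (hy : y ∈ surfDomain Φ p₀ z₀) :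
    surfCoord Φ p₀ z₀ y ∈ (extChartAt (𝓡 4) z₀).target :=
  (extChartAt (𝓡 4) z₀).map_source hy.2

/-- The covariant derivative in the chart of `N` in which it is defined. -/
lemma metric_covDeriv_center (hΦ : ContMDiff (𝓡 2) (𝓡 4) ∞ Φ) {V : FieldAlong Φ} (hV : V.Smooth)
    {p₀ : S} {y : Coord 2} (hy : y ∈ (extChartAt (𝓡 2) p₀).target)
    (w : TangentSpace (𝓡 4) (Φ ((extChartAt (𝓡 2) p₀).symm y))) (c : Coord 2) {z₁ : N}
    (hz₁ : z₁ = Φ ((extChartAt (𝓡 2) p₀).symm y)) :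
    g.val (Φ ((extChartAt (𝓡 2) p₀).symm y)) w
        (covDeriv g Φ V _ (frame p₀ ((extChartAt (𝓡 2) p₀).symm y) c)) =
      bilinCoord g.val z₁ (surfCoord Φ p₀ z₁ y) (comps z₁ _ w)
        (fderiv ℝ (fieldCoord V p₀ z₁) y c) +
      christoffelForm (fderiv ℝ (bilinCoord g.val z₁) (surfCoord Φ p₀ z₁ y))
        (fieldCoord V p₀ z₁ y) (fderiv ℝ (surfCoord Φ p₀ z₁) y c) (comps z₁ _ w) := by
  subst hz₁
  set q := (extChartAt (𝓡 2) p₀).symm y with hq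
  have hyz : y ∈ surfDomain Φ p₀ (Φ q) := mem_mapDomain_self Φ hy
  let L : Coord 2 →L[ℝ] Coord 4 :=
    (mfderiv (𝓡 2) 𝓘(ℝ, Coord 4) (fun p => comps (Φ q) (Φ p) (V p)) q) ∘L (frame p₀ q)
  have hd : HasFDerivAt (fieldCoord V p₀ (Φ q)) L y :=
    MDifferentiableAt.hasFDerivAt_localRep hy (hV.mdifferentiableAt_comps q)
  have hcov : comps (Φ q) (Φ q) (covDeriv g Φ V q (frame p₀ q c)) =
      fderiv ℝ (fieldCoord V p₀ (Φ q)) y c +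
        christoffel g.val (Φ q) (fieldCoord V p₀ (Φ q) y) (fderiv ℝ (surfCoord Φ p₀ (Φ q)) y c) := by
    rw [hd.fderiv, ← comps_differential_frame hΦ hyz]
    exact comps_frame (mem_extChartAt_source (I := 𝓡 4) (Φ q)) _
  have hchr : ∀ a b c : Coord 4, bilinCoord g.val (Φ q) (surfCoord Φ p₀ (Φ q) y) a
      (christoffel g.val (Φ q) b c) = christoffelForm
        (fderiv ℝ (bilinCoord g.val (Φ q)) (surfCoord Φ p₀ (Φ q) y)) b c a := fun a b c => by
    rw [g.bilinCoord_symm]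
    exact congrArg (fun l => l a)
      (bilinCoord_center_apply_inverse g (Φ q) (christoffelLower g.val (Φ q) b c))
  rw [metric_apply_eq g hyz, hcov, map_add, hchr]

/-- The covariant derivative in an arbitrary chart of `N`. -/
lemma metric_covDeriv (hΦ : ContMDiff (𝓡 2) (𝓡 4) ∞ Φ) {V : FieldAlong Φ} (hV : V.Smooth)
    {p₀ : S} {z₀ : N} {y : Coord 2} (hy : y ∈ surfDomain Φ p₀ z₀)
    (w : TangentSpace (𝓡 4) (Φ ((extChartAt (𝓡 2) p₀).symm y))) (c : Coord 2) :
    g.val (Φ ((extChartAt (𝓡 2) p₀).symm y)) w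
        (covDeriv g Φ V _ (frame p₀ ((extChartAt (𝓡 2) p₀).symm y) c)) =
      bilinCoord g.val z₀ (surfCoord Φ p₀ z₀ y) (comps z₀ _ w)
        (fderiv ℝ (fieldCoord V p₀ z₀) y c) +
      christoffelForm (fderiv ℝ (bilinCoord g.val z₀) (surfCoord Φ p₀ z₀ y))
        (fieldCoord V p₀ z₀ y) (fderiv ℝ (surfCoord Φ p₀ z₀) y c) (comps z₀ _ w) := by
  -- The chart belonging to the image point, in which `covDeriv` is defined. Its center is kept as a
  -- separate variable, distinct from the point at which the chart is used.
  obtain ⟨z₁, hz₁⟩ : ∃ z₁, z₁ = Φ ((extChartAt (𝓡 2) p₀).symm y) := ⟨_, rfl⟩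
  have hy₁ : y ∈ surfDomain Φ p₀ z₁ := by
    rw [hz₁]
    exact mem_mapDomain_self Φ hy.1
  rw [metric_covDeriv_center hΦ hV hy.1 w c hz₁]
  set Y := surfCoord Φ p₀ z₀ y with hY
  set τ := transition (n := 4) z₀ z₁ with hτdef
  have hinv : (extChartAt (𝓡 4) z₀).symm Y = Φ ((extChartAt (𝓡 2) p₀).symm y) :=
    (extChartAt (𝓡 4) z₀).left_inv hy.2
  have hYo : Y ∈ overlap (n := 4) z₀ z₁ := by
    refine ⟨surfCoord_mem_target hy, ?_⟩
    rw [mem_preimage, hinv]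
    exact hy₁.2
  have hoo : IsOpen (overlap (n := 4) z₀ z₁) :=
    isOpen_mapDomain (n := 4) (m := 4) continuous_id z₀ z₁
  have hτ : ContDiffAt ℝ 2 τ Y := by
    have h1 := ContMDiff.contDiffOn_mapCoord (n := 4) (m := 4) (k := 2) (f := (id : N → N)) contMDiff_id z₀ z₁
    exact h1.contDiffAt (hoo.mem_nhds hYo)
  have hτ2 : DifferentiableAt ℝ (fderiv ℝ τ) Y :=
    (hτ.fderiv_right (m := 1) (by norm_num)).differentiableAt one_ne_zero
  have hτY : τ Y = surfCoord Φ p₀ z₁ y := congrArg (extChartAt (𝓡 4) z₁) hinv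
  have hcomps : ∀ v : TangentSpace (𝓡 4) (Φ ((extChartAt (𝓡 2) p₀).symm y)),
      comps z₁ _ v = fderiv ℝ τ Y (comps z₀ _ v) := comps_eq_fderiv_transition hy.2 hy₁.2
  have hG : ∀ z : N, ∀ Y ∈ (extChartAt (𝓡 4) z).target,
      DifferentiableAt ℝ (bilinCoord g.val z) Y := fun z Y h =>
    ((g.contDiffOn_bilinCoord z).differentiableOn (by simp)).differentiableAt
      ((isOpen_extChartAt_target z).mem_nhds h)
  have hS : ∀ z, y ∈ surfDomain Φ p₀ z → surfDomain Φ p₀ z ∈ 𝓝 y := fun z h =>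
    (isOpen_mapDomain hΦ.continuous p₀ z).mem_nhds h
  have hVd : DifferentiableAt ℝ (fieldCoord V p₀ z₀) y :=
    ((hV.contDiffOn_fieldCoord p₀ z₀).differentiableOn (by simp)).differentiableAt (hS z₀ hy)
  have hFd : DifferentiableAt ℝ (surfCoord Φ p₀ z₀) y :=
    ((ContMDiff.contDiffOn_mapCoord (k := ⊤) hΦ p₀ z₀).differentiableOn
      (by simp)).differentiableAt (hS z₀ hy)
  have hV₁ : fieldCoord V p₀ z₁ =ᶠ[𝓝 y]
      fun y' => fderiv ℝ τ (surfCoord Φ p₀ z₀ y') (fieldCoord V p₀ z₀ y') := by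
    filter_upwards [hS z₀ hy, hS z₁ hy₁] with y' h0 h1
    exact comps_eq_fderiv_transition h0.2 h1.2 _
  have hdV : fderiv ℝ (fieldCoord V p₀ z₁) y c =
      fderiv ℝ (fderiv ℝ τ) Y (fderiv ℝ (surfCoord Φ p₀ z₀) y c) (fieldCoord V p₀ z₀ y) +
        fderiv ℝ τ Y (fderiv ℝ (fieldCoord V p₀ z₀) y c) := by
    have h1 : HasFDerivAt (fun y' => fderiv ℝ τ (surfCoord Φ p₀ z₀ y'))
        ((fderiv ℝ (fderiv ℝ τ) Y) ∘L (fderiv ℝ (surfCoord Φ p₀ z₀) y)) y :=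
      HasFDerivAt.comp y (g := fderiv ℝ τ) hτ2.hasFDerivAt hFd.hasFDerivAt
    rw [hV₁.fderiv_eq, (h1.clm_apply hVd.hasFDerivAt).fderiv, add_comm]
    rfl
  have hdF : fderiv ℝ (surfCoord Φ p₀ z₁) y c = fderiv ℝ τ Y (fderiv ℝ (surfCoord Φ p₀ z₀) y c) := by
    rw [← comps_differential_frame hΦ hy₁, ← comps_differential_frame hΦ hy]
    exact hcomps _
  have hpull : ∀ᶠ Z in 𝓝 Y, bilinCoord g.val z₀ Z =
      pullbackForm (bilinCoord g.val z₁ (τ Z)) (fderiv ℝ τ Z) := by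
    filter_upwards [hoo.mem_nhds hYo] with Z hZ using bilinCoord_eq_pullbackForm g.val hZ
  have hV0 : fieldCoord V p₀ z₁ y = fderiv ℝ τ Y (fieldCoord V p₀ z₀ y) := hV₁.self_of_nhds
  -- The second derivative of `τ` enters on one side through the derivative of the transformed
  -- components of `V`, on the other through the law for the Christoffel symbols, and the two
  -- contributions are equal.
  rw [christoffelForm_pullbackForm (hG z₀ Y hYo.1) (hG z₁ (τ Y) (transition_mem_target hYo)) hτ
    (g.bilinCoord_symm z₁ (τ Y)) hpull, hpull.self_of_nhds, pullbackForm_apply, hdV, hdF, hV0,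
    hcomps w, ← hτY, map_add, g.bilinCoord_symm z₁ (τ Y) (fderiv ℝ τ Y _)
      (fderiv ℝ (fderiv ℝ τ) Y _ _)]
  ring

end CovariantDerivative

/-! ### Smoothness of fields along the surface, and the rules for the covariant derivative. -/

section SmoothFields

open Filter Topology

variable {N : Type*} [TopologicalSpace N] [ChartedSpace (Coord 4) N] [IsManifold (𝓡 4) ∞ N]
  {S : Type*} [TopologicalSpace S] [ChartedSpace (Coord 2) S] [IsManifold (𝓡 2) ∞ S]
  {Φ : S → N} {g : LorentzMetric N}

lemma IsSpacelikeEmbedding.contMDiff (hΦ : IsSpacelikeEmbedding g Φ) :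
    ContMDiff (𝓡 2) (𝓡 4) ∞ Φ := hΦ.embedding.contMDiff

lemma FieldAlong.smooth_of_contDiffOn (hΦ : ContMDiff (𝓡 2) (𝓡 4) ∞ Φ) {V : FieldAlong Φ}
    (hV : ∀ p₀ z₀, ContDiffOn ℝ ∞ (fieldCoord V p₀ z₀) (surfDomain Φ p₀ z₀)) : V.Smooth := by
  refine FieldAlong.smooth_of_fieldCoord hΦ fun p => (hV p (Φ p)).contDiffAt
    ((isOpen_mapDomain hΦ.continuous p (Φ p)).mem_nhds ⟨mem_extChartAt_target p, ?_⟩)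
  rw [mem_preimage, extChartAt_to_inv]
  exact mem_extChartAt_source _

lemma contDiffOn_surfCoord (hΦ : ContMDiff (𝓡 2) (𝓡 4) ∞ Φ) (p₀ : S) (z₀ : N) :
    ContDiffOn ℝ ∞ (surfCoord Φ p₀ z₀) (surfDomain Φ p₀ z₀) :=
  ContMDiff.contDiffOn_mapCoord (k := ⊤) hΦ p₀ z₀

lemma contDiffOn_scalar {f : S → ℝ} (hf : ContMDiff (𝓡 2) 𝓘(ℝ, ℝ) ∞ f) (p₀ : S) :
    ContDiffOn ℝ ∞ (fun y => f ((extChartAt (𝓡 2) p₀).symm y)) (extChartAt (𝓡 2) p₀).target :=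
  ContMDiff.contDiffOn_localRep (k := ⊤) hf p₀

lemma fieldCoord_smul (f : S → ℝ) (V : FieldAlong Φ) (p₀ : S) (z₀ : N) (y : Coord 2) :
    fieldCoord (fun p => f p • V p) p₀ z₀ y =
      f ((extChartAt (𝓡 2) p₀).symm y) • fieldCoord V p₀ z₀ y := map_smul _ _ _

lemma fieldCoord_add (V W : FieldAlong Φ) (p₀ : S) (z₀ : N) (y : Coord 2) :
    fieldCoord (fun p => V p + W p) p₀ z₀ y = fieldCoord V p₀ z₀ y + fieldCoord W p₀ z₀ y :=
  map_add _ _ _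

lemma FieldAlong.Smooth.smul (hΦ : ContMDiff (𝓡 2) (𝓡 4) ∞ Φ) {V : FieldAlong Φ} (hV : V.Smooth)
    {f : S → ℝ} (hf : ContMDiff (𝓡 2) 𝓘(ℝ, ℝ) ∞ f) :
    FieldAlong.Smooth (Φ := Φ) fun p => f p • V p := by
  refine FieldAlong.smooth_of_contDiffOn hΦ fun p₀ z₀ => ?_
  exact (((contDiffOn_scalar hf p₀).mono inter_subset_left).smul
    (hV.contDiffOn_fieldCoord p₀ z₀)).congr fun y _ => fieldCoord_smul f V p₀ z₀ y

lemma FieldAlong.Smooth.add (hΦ : ContMDiff (𝓡 2) (𝓡 4) ∞ Φ) {V W : FieldAlong Φ} (hV : V.Smooth)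
    (hW : W.Smooth) : FieldAlong.Smooth (Φ := Φ) fun p => V p + W p := by
  refine FieldAlong.smooth_of_contDiffOn hΦ fun p₀ z₀ => ?_
  exact ((hV.contDiffOn_fieldCoord p₀ z₀).add (hW.contDiffOn_fieldCoord p₀ z₀)).congr
    fun y _ => fieldCoord_add V W p₀ z₀ y

lemma FieldAlong.Smooth.sub (hΦ : ContMDiff (𝓡 2) (𝓡 4) ∞ Φ) {V W : FieldAlong Φ} (hV : V.Smooth)
    (hW : W.Smooth) : FieldAlong.Smooth (Φ := Φ) fun p => V p - W p := by
  refine FieldAlong.smooth_of_contDiffOn hΦ fun p₀ z₀ => ?_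
  exact ((hV.contDiffOn_fieldCoord p₀ z₀).sub (hW.contDiffOn_fieldCoord p₀ z₀)).congr
    fun y _ => map_sub _ _ _

lemma contMDiff_metric (hΦ : ContMDiff (𝓡 2) (𝓡 4) ∞ Φ) {V W : FieldAlong Φ} (hV : V.Smooth)
    (hW : W.Smooth) : ContMDiff (𝓡 2) 𝓘(ℝ, ℝ) ∞ fun p => g.val (Φ p) (V p) (W p) := by
  have h2 := ContMDiff.clm_bundle_apply₂ (F₁ := Coord 4) (F₂ := Coord 4) (F₃ := ℝ)
    (E₃ := Bundle.Trivial N ℝ) (g.smooth.comp hΦ) hV hW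
  intro x
  have h3 := h2 x
  simp only [contMDiffAt_totalSpace] at h3
  exact h3.2

lemma contDiffOn_fderiv_surfCoord (hΦ : ContMDiff (𝓡 2) (𝓡 4) ∞ Φ) (p₀ : S) (z₀ : N) :
    ContDiffOn ℝ ∞ (fderiv ℝ (surfCoord Φ p₀ z₀)) (surfDomain Φ p₀ z₀) :=
  (contDiffOn_surfCoord hΦ p₀ z₀).fderiv_of_isOpen (isOpen_mapDomain hΦ.continuous p₀ z₀)
    (by simp)

lemma contDiffOn_metric_surfCoord (g : LorentzMetric N) (hΦ : ContMDiff (𝓡 2) (𝓡 4) ∞ Φ)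
    (p₀ : S) (z₀ : N) :
    ContDiffOn ℝ ∞ (fun y => bilinCoord g.val z₀ (surfCoord Φ p₀ z₀ y)) (surfDomain Φ p₀ z₀) :=
  (g.contDiffOn_bilinCoord z₀).comp (contDiffOn_surfCoord hΦ p₀ z₀)
    fun _ hy => surfCoord_mem_target hy

lemma contDiffOn_fderiv_comp_apply {D E F : Type*} [NormedAddCommGroup D] [NormedSpace ℝ D]
    [NormedAddCommGroup E] [NormedSpace ℝ E] [NormedAddCommGroup F] [NormedSpace ℝ F]
    {G : E → F} {T : Set E} {σ u : D → E} {U : Set D} (hG : ContDiffOn ℝ ∞ G T) (hT : IsOpen T)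
    (hσ : ContDiffOn ℝ ∞ σ U) (hU : MapsTo σ U T) (hu : ContDiffOn ℝ ∞ u U) :
    ContDiffOn ℝ ∞ (fun y => fderiv ℝ G (σ y) (u y)) U :=
  ((hG.fderiv_of_isOpen hT (m := ∞) (by simp)).comp hσ hU).clm_apply hu

set_option synthInstance.maxHeartbeats 200000 in
lemma contDiffOn_christoffelForm (g : LorentzMetric N) (hΦ : ContMDiff (𝓡 2) (𝓡 4) ∞ Φ)
    (p₀ : S) (z₀ : N) {u v w : Coord 2 → Coord 4} (hu : ContDiffOn ℝ ∞ u (surfDomain Φ p₀ z₀))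
    (hv : ContDiffOn ℝ ∞ v (surfDomain Φ p₀ z₀)) (hw : ContDiffOn ℝ ∞ w (surfDomain Φ p₀ z₀)) :
    ContDiffOn ℝ ∞ (fun y => christoffelForm (fderiv ℝ (bilinCoord g.val z₀)
      (surfCoord Φ p₀ z₀ y)) (v y) (u y) (w y)) (surfDomain Φ p₀ z₀) := by
  have key : ∀ {a b c : Coord 2 → Coord 4}, ContDiffOn ℝ ∞ a (surfDomain Φ p₀ z₀) →
      ContDiffOn ℝ ∞ b (surfDomain Φ p₀ z₀) → ContDiffOn ℝ ∞ c (surfDomain Φ p₀ z₀) →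
      ContDiffOn ℝ ∞ (fun y => fderiv ℝ (bilinCoord g.val z₀) (surfCoord Φ p₀ z₀ y)
        (a y) (b y) (c y)) (surfDomain Φ p₀ z₀) := fun {a b c} ha hb hc => by
    have h1 := contDiffOn_fderiv_comp_apply (F := Coord 4 →L[ℝ] Coord 4 →L[ℝ] ℝ)
      (G := bilinCoord g.val z₀) (σ := surfCoord Φ p₀ z₀) (u := a) (g.contDiffOn_bilinCoord z₀)
      (isOpen_extChartAt_target z₀) (contDiffOn_surfCoord hΦ p₀ z₀)
      (fun _ hy => surfCoord_mem_target hy) ha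
    exact (h1.clm_apply hb).clm_apply hc
  exact contDiffOn_const.mul (((key hu hv hw).add (key hv hu hw)).sub (key hw hv hu))

/-- A function on a chart domain of `S` is smooth if it is so on the part mapped to each chart domain
of `N`. -/
lemma contDiffOn_target_of_surfDomain (hΦ : ContMDiff (𝓡 2) (𝓡 4) ∞ Φ) {k : WithTop ℕ∞}
    {E : Type*} [NormedAddCommGroup E] [NormedSpace ℝ E] {f : Coord 2 → E} {p₀ : S}
    (h : ∀ z₀ : N, ContDiffOn ℝ k f (surfDomain Φ p₀ z₀)) :
    ContDiffOn ℝ k f (extChartAt (𝓡 2) p₀).target := fun _ hy =>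
  ((h _).contDiffAt ((isOpen_mapDomain hΦ.continuous p₀ _).mem_nhds
    (mem_mapDomain_self Φ hy))).contDiffWithinAt

lemma contDiffOn_bilinCoord_induced (g : LorentzMetric N) (hΦ : ContMDiff (𝓡 2) (𝓡 4) ∞ Φ)
    (p₀ : S) : ContDiffOn ℝ ∞ (bilinCoord (induced g Φ) p₀) (extChartAt (𝓡 2) p₀).target := by
  refine contDiffOn_target_of_surfDomain hΦ fun z₀ => contDiffOn_clm_apply.2 fun c =>
    contDiffOn_clm_apply.2 fun d => ?_
  have hd : ∀ c, ContDiffOn ℝ ∞ (fun y => fderiv ℝ (surfCoord Φ p₀ z₀) y c) (surfDomain Φ p₀ z₀) :=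
    fun c => (contDiffOn_fderiv_surfCoord hΦ p₀ z₀).clm_apply contDiffOn_const
  refine (((contDiffOn_metric_surfCoord g hΦ p₀ z₀).clm_apply (hd c)).clm_apply (hd d)).congr
    fun y hy => ?_
  rw [bilinCoord_induced g hΦ hy, pullbackForm_apply]

lemma IsSpacelikeEmbedding.isRiemannian_induced (hΦ : IsSpacelikeEmbedding g Φ) :
    IsRiemannian (induced g Φ) where
  symm _ _ _ := g.symm _ _ _
  pos := hΦ.spacelike
  contDiffOn p₀ := (contDiffOn_bilinCoord_induced g hΦ.contMDiff p₀).of_le (by simp)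

/-- The 1-form `X ↦ ⟨V, dΦ(X)⟩`. -/
def tangentialForm (g : LorentzMetric N) (V : FieldAlong Φ) : OneForm 2 S := fun p =>
  (g.val (Φ p) (V p)) ∘L (differential Φ p)

/-- The tangential part is `dΦ` applied to the dual vector of `tangentialForm g V`; in coordinates
this is built from smooth components and the inverse of the induced metric. -/
lemma FieldAlong.Smooth.normalProj (hΦ : IsSpacelikeEmbedding g Φ) {V : FieldAlong Φ}
    (hV : V.Smooth) : FieldAlong.Smooth (Φ := Φ) fun p => normalProj g Φ p (V p) := by
  have hh := hΦ.isRiemannian_induced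
  have hs := hΦ.contMDiff
  refine FieldAlong.smooth_of_contDiffOn hs fun p₀ z₀ => ?_
  have hform : ContDiffOn ℝ ∞ (formCoord (tangentialForm g V) p₀) (surfDomain Φ p₀ z₀) := by
    refine contDiffOn_clm_apply.2 fun c => ?_
    have hd : ContDiffOn ℝ ∞ (fun y => fderiv ℝ (surfCoord Φ p₀ z₀) y c) (surfDomain Φ p₀ z₀) :=
      (contDiffOn_fderiv_surfCoord hs p₀ z₀).clm_apply contDiffOn_const
    refine (((contDiffOn_metric_surfCoord g hs p₀ z₀).clm_apply
      (hV.contDiffOn_fieldCoord p₀ z₀)).clm_apply hd).congr fun y hy => ?_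
    rw [← comps_differential_frame hs hy]
    exact metric_apply_eq g hy _ _
  have hinv : ContDiffOn ℝ ∞ (fun y => (bilinCoord (induced g Φ) p₀ y).inverse)
      (surfDomain Φ p₀ z₀) := fun y hy =>
    (contDiffAt_inverse_of_pos fun c hc => hh.bilinCoord_pos hy.1 hc).comp_contDiffWithinAt y
      ((contDiffOn_bilinCoord_induced g hs p₀).mono inter_subset_left y hy)
  refine ((hV.contDiffOn_fieldCoord p₀ z₀).sub ((contDiffOn_fderiv_surfCoord hs p₀ z₀).clm_apply
    (hinv.clm_apply hform))).congr fun y hy => ?_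
  rw [← comps_differential_frame hs hy, hh.frame_inverse_formCoord _ hy.1]
  exact map_sub _ _ _

/-! ### Leibniz rule and compatibility with the metric -/

-- The rules are stated after pairing with a vector `w`, since `metric_covDeriv` describes these
-- pairings; only Christoffel symbols of the first kind then occur.
set_option synthInstance.maxHeartbeats 200000 in
lemma metric_covDeriv_add (hΦ : ContMDiff (𝓡 2) (𝓡 4) ∞ Φ) {V W : FieldAlong Φ} (hV : V.Smooth)
    (hW : W.Smooth) {p₀ : S} {y : Coord 2} (hy : y ∈ (extChartAt (𝓡 2) p₀).target)
    (w : TangentSpace (𝓡 4) (Φ ((extChartAt (𝓡 2) p₀).symm y))) (c : Coord 2) :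
    g.val _ w (covDeriv g Φ (fun p => V p + W p) _
        (frame p₀ ((extChartAt (𝓡 2) p₀).symm y) c)) =
      g.val _ w (covDeriv g Φ V _ (frame p₀ ((extChartAt (𝓡 2) p₀).symm y) c)) +
      g.val _ w (covDeriv g Φ W _ (frame p₀ ((extChartAt (𝓡 2) p₀).symm y) c)) := by
  obtain ⟨z₀, hyz⟩ : ∃ z₀, y ∈ surfDomain Φ p₀ z₀ := ⟨_, mem_mapDomain_self Φ hy⟩
  have hn := (isOpen_mapDomain hΦ.continuous p₀ z₀).mem_nhds hyz
  have hVd := ((hV.contDiffOn_fieldCoord p₀ z₀).differentiableOn (by simp)).differentiableAt hn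
  have hWd := ((hW.contDiffOn_fieldCoord p₀ z₀).differentiableOn (by simp)).differentiableAt hn
  rw [metric_covDeriv hΦ (hV.add hΦ hW) hyz, metric_covDeriv hΦ hV hyz, metric_covDeriv hΦ hW hyz]
  have e1 : fderiv ℝ (fieldCoord (fun p => V p + W p) p₀ z₀) y c =
      fderiv ℝ (fieldCoord V p₀ z₀) y c + fderiv ℝ (fieldCoord W p₀ z₀) y c := by
    have : fieldCoord (fun p => V p + W p) p₀ z₀ = fieldCoord V p₀ z₀ + fieldCoord W p₀ z₀ :=
      funext fun y => fieldCoord_add V W p₀ z₀ y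
    rw [this, fderiv_add hVd hWd]
    rfl
  rw [e1, fieldCoord_add]
  simp only [christoffelForm, map_add, add_apply]
  ring

set_option synthInstance.maxHeartbeats 200000 in
lemma metric_covDeriv_smul (hΦ : ContMDiff (𝓡 2) (𝓡 4) ∞ Φ) {V : FieldAlong Φ} (hV : V.Smooth)
    {f : S → ℝ} (hf : ContMDiff (𝓡 2) 𝓘(ℝ, ℝ) ∞ f) {p₀ : S} {y : Coord 2}
    (hy : y ∈ (extChartAt (𝓡 2) p₀).target)
    (w : TangentSpace (𝓡 4) (Φ ((extChartAt (𝓡 2) p₀).symm y))) (c : Coord 2) :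
    g.val _ w (covDeriv g Φ (fun p => f p • V p) _
        (frame p₀ ((extChartAt (𝓡 2) p₀).symm y) c)) =
      fderiv ℝ (fun y => f ((extChartAt (𝓡 2) p₀).symm y)) y c *
        g.val _ w (V ((extChartAt (𝓡 2) p₀).symm y)) +
      f ((extChartAt (𝓡 2) p₀).symm y) *
        g.val _ w (covDeriv g Φ V _ (frame p₀ ((extChartAt (𝓡 2) p₀).symm y) c)) := by
  obtain ⟨z₀, hyz⟩ : ∃ z₀, y ∈ surfDomain Φ p₀ z₀ := ⟨_, mem_mapDomain_self Φ hy⟩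
  have hn := (isOpen_mapDomain hΦ.continuous p₀ z₀).mem_nhds hyz
  have hVd := ((hV.contDiffOn_fieldCoord p₀ z₀).differentiableOn (by simp)).differentiableAt hn
  have hfd : DifferentiableAt ℝ (fun y => f ((extChartAt (𝓡 2) p₀).symm y)) y :=
    ((contDiffOn_scalar hf p₀).differentiableOn (by simp)).differentiableAt
      ((isOpen_extChartAt_target p₀).mem_nhds hy)
  rw [metric_covDeriv hΦ (hV.smul hΦ hf) hyz, metric_covDeriv hΦ hV hyz]
  have e1 : fderiv ℝ (fieldCoord (fun p => f p • V p) p₀ z₀) y c =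
      f ((extChartAt (𝓡 2) p₀).symm y) • fderiv ℝ (fieldCoord V p₀ z₀) y c +
        fderiv ℝ (fun y => f ((extChartAt (𝓡 2) p₀).symm y)) y c • fieldCoord V p₀ z₀ y := by
    have : fieldCoord (fun p => f p • V p) p₀ z₀ =
        fun y => f ((extChartAt (𝓡 2) p₀).symm y) • fieldCoord V p₀ z₀ y :=
      funext fun y => fieldCoord_smul f V p₀ z₀ y
    rw [this, fderiv_fun_smul hfd hVd]
    rfl
  have e2 := metric_apply_eq g hyz w (V ((extChartAt (𝓡 2) p₀).symm y))
  change _ = bilinCoord g.val z₀ (surfCoord Φ p₀ z₀ y) (comps z₀ _ w) (fieldCoord V p₀ z₀ y) at e2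
  rw [e1, fieldCoord_smul, e2]
  simp only [christoffelForm, map_add, map_smul, smul_apply, smul_eq_mul]
  ring

-- Metric compatibility: in the sum of the two first-kind Christoffel terms with `V` and `W`
-- exchanged, everything cancels except the derivative of the metric in the direction of `dΦ`.
set_option synthInstance.maxHeartbeats 200000 in
lemma fderiv_metric_apply (hΦ : ContMDiff (𝓡 2) (𝓡 4) ∞ Φ) {V W : FieldAlong Φ} (hV : V.Smooth)
    (hW : W.Smooth) {p₀ : S} {y : Coord 2} (hy : y ∈ (extChartAt (𝓡 2) p₀).target) (c : Coord 2) :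
    fderiv ℝ (fun y => g.val (Φ ((extChartAt (𝓡 2) p₀).symm y)) (V ((extChartAt (𝓡 2) p₀).symm y))
        (W ((extChartAt (𝓡 2) p₀).symm y))) y c =
      g.val _ (W ((extChartAt (𝓡 2) p₀).symm y))
        (covDeriv g Φ V _ (frame p₀ ((extChartAt (𝓡 2) p₀).symm y) c)) +
      g.val _ (V ((extChartAt (𝓡 2) p₀).symm y))
        (covDeriv g Φ W _ (frame p₀ ((extChartAt (𝓡 2) p₀).symm y) c)) := by
  obtain ⟨z₀, hyz⟩ : ∃ z₀, y ∈ surfDomain Φ p₀ z₀ := ⟨_, mem_mapDomain_self Φ hy⟩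
  have hn := (isOpen_mapDomain hΦ.continuous p₀ z₀).mem_nhds hyz
  have hVd := ((hV.contDiffOn_fieldCoord p₀ z₀).differentiableOn (by simp)).differentiableAt hn
  have hWd := ((hW.contDiffOn_fieldCoord p₀ z₀).differentiableOn (by simp)).differentiableAt hn
  have hFd := ((contDiffOn_surfCoord hΦ p₀ z₀).differentiableOn (by simp)).differentiableAt hn
  have hG : DifferentiableAt ℝ (bilinCoord g.val z₀) (surfCoord Φ p₀ z₀ y) :=
    ((g.contDiffOn_bilinCoord z₀).differentiableOn (by simp)).differentiableAt
      ((isOpen_extChartAt_target z₀).mem_nhds (surfCoord_mem_target hyz))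
  have hGF : DifferentiableAt ℝ (fun y => bilinCoord g.val z₀ (surfCoord Φ p₀ z₀ y)) y :=
    differentiableAt_comp_fun (F := Coord 4 →L[ℝ] Coord 4 →L[ℝ] ℝ) (G := bilinCoord g.val z₀)
      (τ := surfCoord Φ p₀ z₀) hG hFd
  have e : (fun y => g.val (Φ ((extChartAt (𝓡 2) p₀).symm y)) (V ((extChartAt (𝓡 2) p₀).symm y))
      (W ((extChartAt (𝓡 2) p₀).symm y))) =ᶠ[𝓝 y] fun y =>
      bilinCoord g.val z₀ (surfCoord Φ p₀ z₀ y) (fieldCoord V p₀ z₀ y) (fieldCoord W p₀ z₀ y) := by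
    filter_upwards [hn] with y' hy'
    exact metric_apply_eq g hy' _ _
  have e3 := fderiv_bilin_apply (G := fun y => bilinCoord g.val z₀ (surfCoord Φ p₀ z₀ y))
    hGF hVd hWd c
  have e4 := fderiv_comp_apply (F := Coord 4 →L[ℝ] Coord 4 →L[ℝ] ℝ) (G := bilinCoord g.val z₀)
      (τ := surfCoord Φ p₀ z₀) hG hFd c
  rw [e4] at e3
  rw [e.fderiv_eq, e3, metric_covDeriv hΦ hV hyz, metric_covDeriv hΦ hW hyz]
  have hsymm : ∀ u v w : Coord 4, fderiv ℝ (bilinCoord g.val z₀) (surfCoord Φ p₀ z₀ y) u v w =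
      fderiv ℝ (bilinCoord g.val z₀) (surfCoord Φ p₀ z₀ y) u w v := by
    intro u v w
    have a := fderiv_bilin_apply hG (differentiableAt_const v) (differentiableAt_const w) u
    have b := fderiv_bilin_apply hG (differentiableAt_const w) (differentiableAt_const v) u
    simp only [fderiv_fun_const, Pi.zero_apply, zero_apply, map_zero, add_zero] at a b
    rw [← a, ← b]
    simp only [g.bilinCoord_symm z₀ _ v w]
  change _ = bilinCoord g.val z₀ _ (fieldCoord W p₀ z₀ y) _ +
    christoffelForm _ _ _ (fieldCoord W p₀ z₀ y) + (bilinCoord g.val z₀ _ (fieldCoord V p₀ z₀ y) _ +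
    christoffelForm _ _ _ (fieldCoord V p₀ z₀ y))
  rw [g.bilinCoord_symm z₀ _ (fieldCoord W p₀ z₀ y)]
  simp only [christoffelForm]
  rw [hsymm (fieldCoord V p₀ z₀ y) (fieldCoord W p₀ z₀ y),
    hsymm (fieldCoord W p₀ z₀ y) (fieldCoord V p₀ z₀ y),
    hsymm _ (fieldCoord W p₀ z₀ y) (fieldCoord V p₀ z₀ y)]
  ring

end SmoothFields

/-! ### Frames of the normal bundle, hyperbolic rotations and the connection form. -/

section NormalBundle

open Filter Topology

variable {N : Type*} [TopologicalSpace N] [ChartedSpace (Coord 4) N] [IsManifold (𝓡 4) ∞ N]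
  {S : Type*} [TopologicalSpace S] [ChartedSpace (Coord 2) S] [IsManifold (𝓡 2) ∞ S]
  {Φ : S → N} {g : LorentzMetric N} {T : TimeOrientation g} {O : OutwardDirection g Φ}

lemma OneForm.ext_formCoord {a b : OneForm 2 S}
    (h : ∀ p₀ : S, ∀ y ∈ (extChartAt (𝓡 2) p₀).target, ∀ c, formCoord a p₀ y c = formCoord b p₀ y c) :
    a = b := by
  funext p
  -- The forms at `p` live on a space depending on `p`, so the point is generalized before the
  -- equation between points is eliminated.
  have key : ∀ q, (extChartAt (𝓡 2) p).symm (extChartAt (𝓡 2) p p) = q → a q = b q := by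
    rintro q rfl
    refine ContinuousLinearMap.ext fun v => ?_
    have h1 := h p _ (mem_extChartAt_target p) (comps (n := 2) p _ v)
    rw [formCoord_apply, formCoord_apply, frame_comps ((extChartAt (𝓡 2) p).map_target
      (mem_extChartAt_target p))] at h1
    exact h1
  exact key p (extChartAt_to_inv p)

/-! ### The reference frame of the normal bundle -/

/-- The factor normalizing the outward field. -/
lemma refOut_factor_pos (O : OutwardDirection g Φ) (p : S) :
    0 < (√ (g.val (Φ p) (O.field p) (O.field p)))⁻¹ :=
  inv_pos.2 (Real.sqrt_pos.2 (O.spacelike p))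

lemma IsNormal.smul {p : S} {w : TangentSpace (𝓡 4) (Φ p)} (hw : IsNormal g Φ p w) (r : ℝ) :
    IsNormal g Φ p (r • w) := fun X => by
  rw [map_smul, smul_apply, hw X, smul_zero]

lemma IsNormal.add {p : S} {v w : TangentSpace (𝓡 4) (Φ p)} (hv : IsNormal g Φ p v)
    (hw : IsNormal g Φ p w) : IsNormal g Φ p (v + w) := fun X => by
  rw [map_add, add_apply, hv X, hw X, add_zero]

lemma IsNormal.sub {p : S} {v w : TangentSpace (𝓡 4) (Φ p)} (hv : IsNormal g Φ p v)
    (hw : IsNormal g Φ p w) : IsNormal g Φ p (v - w) := fun X => by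
  rw [map_sub, sub_apply, hv X, hw X, sub_zero]

lemma isNormal_refOut (p : S) : IsNormal g Φ p (refOut O p) := (O.normal p).smul _

lemma metric_refOut_self (O : OutwardDirection g Φ) (p : S) :
    g.val (Φ p) (refOut O p) (refOut O p) = 1 := by
  have h := O.spacelike p
  rw [refOut, map_smul, map_smul, smul_apply, smul_eq_mul, smul_eq_mul, ← mul_assoc, ← mul_inv,
    Real.mul_self_sqrt h.le, inv_mul_cancel₀ h.ne']

variable (hΦ : IsSpacelikeEmbedding g Φ)
include hΦ

lemma isNormal_refTimeAux (T : TimeOrientation g) (O : OutwardDirection g Φ) (p : S) :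
    IsNormal g Φ p (refTimeAux T O p) :=
  (isNormal_normalProj hΦ p _).sub ((isNormal_refOut p).smul _)

/-- The time field splits orthogonally into `refTimeAux`, a tangential part and a multiple of
`refOut`. The last two have nonnegative square and the sum is timelike, so the first is timelike. -/
lemma metric_refTimeAux (T : TimeOrientation g) (O : OutwardDirection g Φ) (p : S) :
    g.val (Φ p) (refTimeAux T O p) (refOut O p) = 0 ∧
      g.val (Φ p) (refTimeAux T O p) (T.field (Φ p)) =
        g.val (Φ p) (refTimeAux T O p) (refTimeAux T O p) ∧
      g.val (Φ p) (refTimeAux T O p) (refTimeAux T O p) < 0 := by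
  have haux := isNormal_refTimeAux hΦ T O p
  have hv := isNormal_refOut (O := O) p
  have hvv := metric_refOut_self O p
  obtain ⟨X, hX⟩ : ∃ X, T.field (Φ p) = normalProj g Φ p (T.field (Φ p)) + differential Φ p X :=
    ⟨(induced g Φ p).inverse ((g.val (Φ p) (T.field (Φ p))) ∘L (differential Φ p)),
      (sub_add_cancel _ _).symm⟩
  obtain ⟨k, hk⟩ : ∃ k, k = g.val (Φ p) (T.field (Φ p)) (refOut O p) := ⟨_, rfl⟩
  have hdec : T.field (Φ p) = refTimeAux T O p + differential Φ p X + k • refOut O p := by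
    rw [refTimeAux, ← hk]
    conv_lhs => rw [hX]
    abel
  have hXX : 0 ≤ g.val (Φ p) (differential Φ p X) (differential Φ p X) := by
    by_cases h0 : X = 0
    · rw [h0]; simp
    · exact (hΦ.spacelike p X h0).le
  have hXv : g.val (Φ p) (differential Φ p X) (refOut O p) = 0 := by rw [g.symm]; exact hv X
  have hXa : g.val (Φ p) (differential Φ p X) (refTimeAux T O p) = 0 := by rw [g.symm]; exact haux X
  have h1 : g.val (Φ p) (refTimeAux T O p) (refOut O p) = 0 := by
    have e : k = g.val (Φ p) (refTimeAux T O p) (refOut O p) + k := by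
      conv_lhs => rw [hk, hdec]
      rw [map_add, map_add, map_smul, add_apply, add_apply, smul_apply, hXv, hvv, smul_eq_mul]
      ring
    linarith
  have h1' : g.val (Φ p) (refOut O p) (refTimeAux T O p) = 0 := by rw [g.symm]; exact h1
  have h2 : g.val (Φ p) (refTimeAux T O p) (T.field (Φ p)) =
        g.val (Φ p) (refTimeAux T O p) (refTimeAux T O p) := by
    conv_lhs => rw [hdec]
    rw [map_add, map_add, map_smul, haux X, h1, smul_zero, add_zero, add_zero]
  refine ⟨h1, h2, ?_⟩
  have h3 := T.timelike (Φ p)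
  have h4 : g.val (Φ p) (T.field (Φ p)) (T.field (Φ p)) =
      g.val (Φ p) (refTimeAux T O p) (refTimeAux T O p) +
        g.val (Φ p) (differential Φ p X) (differential Φ p X) + k * k := by
    rw [hdec]
    simp only [map_add, map_smul, add_apply, smul_apply, smul_eq_mul, haux X, hv X, h1, h1', hvv,
      hXv, hXa]
    ring
  nlinarith [mul_self_nonneg k]

lemma isAdaptedFrame_ref (T : TimeOrientation g) (O : OutwardDirection g Φ) (p : S) :
    IsAdaptedFrame T O p (refTime T O p) (refOut O p) := by
  obtain ⟨h1, h2, h3⟩ := metric_refTimeAux hΦ T O p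
  have hs : 0 < √ (-g.val (Φ p) (refTimeAux T O p) (refTimeAux T O p)) :=
    Real.sqrt_pos.2 (by linarith)
  have hss := Real.mul_self_sqrt (show 0 ≤ -g.val (Φ p) (refTimeAux T O p) (refTimeAux T O p) by
    linarith)
  have huu : g.val (Φ p) (refTime T O p) (refTime T O p) = -1 := by
    rw [refTime, map_smul, map_smul, smul_apply, smul_eq_mul, smul_eq_mul, ← mul_assoc, ← mul_inv,
      hss, inv_neg, neg_mul, inv_mul_cancel₀ h3.ne]
  refine ⟨(isNormal_refTimeAux hΦ T O p).smul _, ⟨by rw [huu]; norm_num, ?_⟩,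
    ⟨isNormal_refOut p, by rw [metric_refOut_self]; norm_num, ?_⟩, huu, metric_refOut_self O p, ?_⟩
  · rw [refTime, map_smul, smul_apply, h2]
    exact mul_neg_of_pos_of_neg (inv_pos.2 hs) h3
  · rw [refOut, map_smul, smul_apply]
    exact mul_pos (refOut_factor_pos O p) (O.spacelike p)
  · rw [refTime, map_smul, smul_apply, h1, smul_zero]

/-! ### Smoothness of the involution -/

lemma smooth_refOut : FieldAlong.Smooth (Φ := Φ) fun p => refOut O p := by
  have hs := hΦ.contMDiff
  refine O.smooth.smul hs fun p => ?_
  have h1 : ContDiffAt ℝ ∞ (fun t : ℝ => (√ t)⁻¹) (g.val (Φ p) (O.field p) (O.field p)) :=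
    (Real.contDiffAt_sqrt (O.spacelike p).ne').inv (Real.sqrt_pos.2 (O.spacelike p)).ne'
  exact ContMDiffAt.comp (g := fun t : ℝ => (√ t)⁻¹) p h1.contMDiffAt
    (contMDiff_metric hs O.smooth O.smooth p)

lemma smooth_refTimeAux : FieldAlong.Smooth (Φ := Φ) fun p => refTimeAux T O p := by
  have hs := hΦ.contMDiff
  have hT : FieldAlong.Smooth (Φ := Φ) fun p => T.field (Φ p) := T.smooth.comp hs
  have hO := smooth_refOut (O := O) hΦ
  exact (hT.normalProj hΦ).sub hs (hO.smul hs (contMDiff_metric hs hT hO))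

lemma smooth_refTime : FieldAlong.Smooth (Φ := Φ) fun p => refTime T O p := by
  have hs := hΦ.contMDiff
  have hA := smooth_refTimeAux (T := T) (O := O) hΦ
  refine hA.smul hs fun p => ?_
  have h0 : 0 < -g.val (Φ p) (refTimeAux T O p) (refTimeAux T O p) := by
    have := (metric_refTimeAux hΦ T O p).2.2
    linarith
  have h1 : ContDiffAt ℝ ∞ (fun t : ℝ => (√ (-t))⁻¹)
      (g.val (Φ p) (refTimeAux T O p) (refTimeAux T O p)) :=
    ((contDiff_neg.contDiffAt).sqrt h0.ne').inv (Real.sqrt_pos.2 h0).ne'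
  exact ContMDiffAt.comp (g := fun t : ℝ => (√ (-t))⁻¹) p h1.contMDiffAt (contMDiff_metric hs hA hA p)

lemma FieldAlong.Smooth.perp {V : FieldAlong Φ} (hV : V.Smooth) :
    FieldAlong.Smooth (Φ := Φ) fun p => perp T O p (V p) := by
  have hs := hΦ.contMDiff
  have hO := smooth_refOut (O := O) hΦ
  have hT := smooth_refTime (T := T) (O := O) hΦ
  exact (hT.smul hs (contMDiff_metric hs hV hO)).sub hs (hO.smul hs (contMDiff_metric hs hV hT))

/-! ### Unit outward normals in the reference frame -/

/-- Scalar products in the reference frame. -/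
lemma metric_ref (T : TimeOrientation g) (O : OutwardDirection g Φ) (p : S) (a b c d : ℝ) :
    g.val (Φ p) (a • refOut O p + b • refTime T O p) (c • refOut O p + d • refTime T O p) =
      a * c - b * d := by
  have h := isAdaptedFrame_ref hΦ T O p
  have h' : g.val (Φ p) (refOut O p) (refTime T O p) = 0 := by rw [g.symm]; exact h.orthogonal
  simp only [map_add, map_smul, add_apply, smul_apply, smul_eq_mul, h.unit_timelike,
    h.unit_spacelike, h.orthogonal, h']
  ring

lemma perp_ref (T : TimeOrientation g) (O : OutwardDirection g Φ) (p : S) (a b : ℝ) :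
    perp T O p (a • refOut O p + b • refTime T O p) = b • refOut O p + a • refTime T O p := by
  have e1 := metric_ref hΦ T O p a b 1 0
  have e2 := metric_ref hΦ T O p a b 0 1
  rw [one_smul, zero_smul, add_zero] at e1
  rw [one_smul, zero_smul, zero_add] at e2
  rw [perp, e1, e2]
  module

lemma isOutward_ref (O : OutwardDirection g Φ) (T : TimeOrientation g) {p : S} {a b : ℝ}
    (ha : 0 < a) (hab : a * a - b * b = 1) :
    O.IsOutward p (a • refOut O p + b • refTime T O p) := by
  have h := isAdaptedFrame_ref hΦ T O p
  refine ⟨((isNormal_refOut p).smul a).add (h.normal.smul b), ?_, ?_⟩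
  · rw [metric_ref hΦ, hab]
    exact one_pos
  · have e1 := metric_ref hΦ T O p a b 1 0
    rw [one_smul, zero_smul, add_zero, refOut, map_smul, smul_eq_mul] at e1
    have h2 := refOut_factor_pos O p
    rw [mul_one, mul_zero, sub_zero] at e1
    rw [← e1] at ha
    exact pos_of_mul_pos_right ha h2.le

lemma IsUnitOutwardNormal.exists_ref (T : TimeOrientation g) {ν : FieldAlong Φ}
    (hν : IsUnitOutwardNormal O ν) (p : S) :
    ∃ a b : ℝ, ν p = a • refOut O p + b • refTime T O p ∧ 0 < a ∧ a * a - b * b = 1 := by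
  have h := isAdaptedFrame_ref hΦ T O p
  have e := h.expand hΦ (hν.outward p).1
  obtain ⟨a, ha⟩ : ∃ a, a = g.val (Φ p) (ν p) (refOut O p) := ⟨_, rfl⟩
  obtain ⟨b, hb⟩ : ∃ b, b = -g.val (Φ p) (ν p) (refTime T O p) := ⟨_, rfl⟩
  have e' : ν p = a • refOut O p + b • refTime T O p := by
    rw [ha, hb, neg_smul, ← sub_eq_add_neg]
    exact e
  refine ⟨a, b, e', ?_, ?_⟩
  · rw [ha, refOut, map_smul]
    exact mul_pos (refOut_factor_pos O p) (hν.outward p).2.2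
  · rw [← metric_ref hΦ T O p a b a b, ← e']
    exact hν.unit p

/-- The scalar products of a unit outward normal and its image under the involution. -/
lemma IsUnitOutwardNormal.metric_perp (T : TimeOrientation g) {ν : FieldAlong Φ}
    (hν : IsUnitOutwardNormal O ν) (p : S) :
    IsNormal g Φ p (perp T O p (ν p)) ∧ g.val (Φ p) (ν p) (perp T O p (ν p)) = 0 ∧
      g.val (Φ p) (perp T O p (ν p)) (perp T O p (ν p)) = -1 ∧
      ∀ a b : ℝ, perp T O p (a • ν p + b • perp T O p (ν p)) = b • ν p + a • perp T O p (ν p) := by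
  have h := isAdaptedFrame_ref hΦ T O p
  obtain ⟨a, b, e, -, hab⟩ := hν.exists_ref hΦ T p
  rw [e, perp_ref hΦ, metric_ref hΦ, metric_ref hΦ]
  refine ⟨((isNormal_refOut p).smul b).add (h.normal.smul a), by ring, by linarith, fun x y => ?_⟩
  have e1 : x • (a • refOut O p + b • refTime T O p) + y • (b • refOut O p + a • refTime T O p) =
      (x * a + y * b) • refOut O p + (x * b + y * a) • refTime T O p := by module
  rw [e1, perp_ref hΦ]
  module

/-- Rotating a unit outward normal by a hyperbolic angle. -/
lemma IsUnitOutwardNormal.rotate (T : TimeOrientation g) {ν : FieldAlong Φ}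
    (hν : IsUnitOutwardNormal O ν) {f : S → ℝ} (hf : ContMDiff (𝓡 2) 𝓘(ℝ, ℝ) ∞ f) :
    IsUnitOutwardNormal O
      (fun p => Real.cosh (f p) • ν p + Real.sinh (f p) • perp T O p (ν p)) := by
  have hs := hΦ.contMDiff
  have key : ∀ p, ∃ a b : ℝ, Real.cosh (f p) • ν p + Real.sinh (f p) • perp T O p (ν p) =
      a • refOut O p + b • refTime T O p ∧ 0 < a ∧ a * a - b * b = 1 := by
    intro p
    obtain ⟨a, b, e, ha, hab⟩ := hν.exists_ref hΦ T p
    have hc := Real.cosh_sq (f p)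
    have hcp := Real.cosh_pos (f p)
    refine ⟨Real.cosh (f p) * a + Real.sinh (f p) * b, Real.cosh (f p) * b + Real.sinh (f p) * a,
      ?_, ?_, ?_⟩
    · rw [e, perp_ref hΦ]
      module
    · have h1 : (Real.sinh (f p) * b) ^ 2 < (Real.cosh (f p) * a) ^ 2 := by
        rw [mul_pow, mul_pow, hc]
        nlinarith [sq_nonneg (Real.sinh (f p)), sq_nonneg b]
      have h2 := abs_lt_of_sq_lt_sq h1 (by positivity)
      linarith [(abs_lt.1 h2).1]
    · linear_combination (Real.cosh (f p) ^ 2 - Real.sinh (f p) ^ 2) * hab + hc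
  refine ⟨?_, fun p => ?_, fun p => ?_⟩
  · exact (hν.smooth.smul hs (Real.contDiff_cosh.contMDiff.comp hf)).add hs
      ((hν.smooth.perp hΦ).smul hs (Real.contDiff_sinh.contMDiff.comp hf))
  · obtain ⟨a, b, e, ha, hab⟩ := key p
    simp only [e]
    exact isOutward_ref hΦ O T ha hab
  · obtain ⟨a, b, e, ha, hab⟩ := key p
    simp only [e]
    rw [metric_ref hΦ, hab]

/-- Two unit outward normals differ by a hyperbolic rotation. -/
lemma IsUnitOutwardNormal.exists_rotate (T : TimeOrientation g) {ν μ : FieldAlong Φ}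
    (hν : IsUnitOutwardNormal O ν) (hμ : IsUnitOutwardNormal O μ) :
    ∃ f : S → ℝ, ContMDiff (𝓡 2) 𝓘(ℝ, ℝ) ∞ f ∧
      μ = fun p => Real.cosh (f p) • ν p + Real.sinh (f p) • perp T O p (ν p) := by
  have hs := hΦ.contMDiff
  -- Pairing `μ = cosh f • ν + sinh f • ν^⊥` with `ν^⊥`, whose square is `-1`, gives `-sinh f`. This
  -- formula shows at once that the angle is smooth.
  refine ⟨fun p => Real.arsinh (-g.val (Φ p) (μ p) (perp T O p (ν p))), ?_, funext fun p => ?_⟩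
  · exact Real.contDiff_arsinh.contMDiff.comp
      (contDiff_neg.contMDiff.comp (contMDiff_metric hs hμ.smooth (hν.smooth.perp hΦ)))
  · obtain ⟨a, b, e, ha, hab⟩ := hν.exists_ref hΦ T p
    obtain ⟨c, d, e', hc, hcd⟩ := hμ.exists_ref hΦ T p
    have h0 : -g.val (Φ p) (μ p) (perp T O p (ν p)) = d * a - c * b := by
      rw [e, e', perp_ref hΦ, metric_ref hΦ]
      ring
    -- The reversed Cauchy–Schwarz inequality on one branch: this number is `⟨μ, ν⟩`, which must be
    -- positive to equal `cosh f`.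
    have h1 : 0 < c * a - d * b := by
      have h1 : (d * b) ^ 2 < (c * a) ^ 2 := by
        rw [mul_pow, mul_pow]
        nlinarith [sq_nonneg d, sq_nonneg b, sq_nonneg a]
      have h2 := abs_lt_of_sq_lt_sq h1 (by positivity)
      linarith [(abs_lt.1 h2).2]
    have h2 : √ (1 + (d * a - c * b) ^ 2) = c * a - d * b := by
      rw [Real.sqrt_eq_iff_mul_self_eq (by positivity) h1.le]
      linear_combination -(c * c - d * d) * hab - hcd
    simp only [h0]
    rw [Real.cosh_arsinh, Real.sinh_arsinh, h2, e, e', perp_ref hΦ]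
    have e1 : (c * a - d * b) * a + (d * a - c * b) * b = c := by linear_combination c * hab
    have e2 : (c * a - d * b) * b + (d * a - c * b) * a = d := by linear_combination d * hab
    conv_lhs => rw [← e1, ← e2]
    module

/-! ### The connection form -/

/-- The vector `ν^⊥` is normal, so the tangential part removed by the projection does not contribute
and the Levi-Civita derivative may be used. -/
lemma connectionForm_apply {ν : FieldAlong Φ} (hν : IsUnitOutwardNormal O ν) (p : S)
    (X : TangentSpace (𝓡 2) p) :
    connectionForm T O ν p X = g.val (Φ p) (perp T O p (ν p)) (covDeriv g Φ ν p X) := by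
  have h := (hν.metric_perp hΦ T p).1
  have e : connectionForm T O ν p X = g.val (Φ p) (perp T O p (ν p))
    (covDeriv g Φ ν p X - differential Φ p ((induced g Φ p).inverse
      ((g.val (Φ p) (covDeriv g Φ ν p X)) ∘L (differential Φ p)))) := rfl
  rw [e, map_sub, h, sub_zero]

lemma isC1_connectionForm {ν : FieldAlong Φ} (hν : IsUnitOutwardNormal O ν) :
    OneForm.IsC1 (connectionForm T O ν) := by
  have hs := hΦ.contMDiff
  intro p₀
  refine contDiffOn_target_of_surfDomain hs fun z₀ => contDiffOn_clm_apply.2 fun c => ?_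
  have hu := (hν.smooth.perp (T := T) (O := O) hΦ).contDiffOn_fieldCoord p₀ z₀
  have hV := hν.smooth.contDiffOn_fieldCoord p₀ z₀
  have hd : ContDiffOn ℝ ∞ (fun y => fderiv ℝ (surfCoord Φ p₀ z₀) y c) (surfDomain Φ p₀ z₀) :=
    (contDiffOn_fderiv_surfCoord hs p₀ z₀).clm_apply contDiffOn_const
  have hdV : ContDiffOn ℝ ∞ (fun y => fderiv ℝ (fieldCoord ν p₀ z₀) y c) (surfDomain Φ p₀ z₀) :=
    (hV.fderiv_of_isOpen (isOpen_mapDomain hs.continuous p₀ z₀) (m := ∞) (by simp)).clm_apply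
      contDiffOn_const
  have key := (((contDiffOn_metric_surfCoord g hs p₀ z₀).clm_apply hu).clm_apply hdV).add
    (contDiffOn_christoffelForm g hs p₀ z₀ hd hV hu)
  refine (key.of_le (by simp)).congr fun y hy => ?_
  rw [formCoord_apply, connectionForm_apply hΦ hν, metric_covDeriv hs hν.smooth hy]
  rfl

/-- The connection form of a rotated normal. -/
lemma connectionForm_rotate {ν : FieldAlong Φ} (hν : IsUnitOutwardNormal O ν) {f : S → ℝ}
    (hf : ContMDiff (𝓡 2) 𝓘(ℝ, ℝ) ∞ f) :
    connectionForm T O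
      (fun p => Real.cosh (f p) • ν p + Real.sinh (f p) • perp T O p (ν p)) =
      connectionForm T O ν - dForm f := by
  have hs := hΦ.contMDiff
  have hu : FieldAlong.Smooth (Φ := Φ) fun p => perp T O p (ν p) := hν.smooth.perp hΦ
  have hch : ContMDiff (𝓡 2) 𝓘(ℝ, ℝ) ∞ fun p => Real.cosh (f p) :=
    Real.contDiff_cosh.contMDiff.comp hf
  have hsh : ContMDiff (𝓡 2) 𝓘(ℝ, ℝ) ∞ fun p => Real.sinh (f p) :=
    Real.contDiff_sinh.contMDiff.comp hf
  refine OneForm.ext_formCoord fun p₀ y hy c => ?_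
  have hfd : DifferentiableAt ℝ (fun y => f ((extChartAt (𝓡 2) p₀).symm y)) y :=
    ((contDiffOn_scalar hf p₀).differentiableOn (by simp)).differentiableAt
      ((isOpen_extChartAt_target p₀).mem_nhds hy)
  have e0 : formCoord (connectionForm T O ν - dForm f) p₀ y c =
      formCoord (connectionForm T O ν) p₀ y c - formCoord (dForm f) p₀ y c := rfl
  rw [e0, formCoord_dForm (hf.of_le (by simp)) hy, formCoord_apply, formCoord_apply,
    connectionForm_apply hΦ hν, connectionForm_apply hΦ (hν.rotate hΦ T hf)]
  have dch : fderiv ℝ (fun y => Real.cosh (f ((extChartAt (𝓡 2) p₀).symm y))) y c =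
      Real.sinh (f ((extChartAt (𝓡 2) p₀).symm y)) *
        fderiv ℝ (fun y => f ((extChartAt (𝓡 2) p₀).symm y)) y c := by
    rw [hfd.hasFDerivAt.cosh.fderiv]
    rfl
  have dsh : fderiv ℝ (fun y => Real.sinh (f ((extChartAt (𝓡 2) p₀).symm y))) y c =
      Real.cosh (f ((extChartAt (𝓡 2) p₀).symm y)) *
        fderiv ℝ (fun y => f ((extChartAt (𝓡 2) p₀).symm y)) y c := by
    rw [hfd.hasFDerivAt.sinh.fderiv]
    rfl
  -- compatibility with the metric for the constant scalar products of the frame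
  have c1 := fderiv_metric_apply (g := g) hs hν.smooth hν.smooth hy c
  have c2 := fderiv_metric_apply (g := g) hs hu hu hy c
  have c3 := fderiv_metric_apply (g := g) hs hν.smooth hu hy c
  have hνν : ∀ p, g.val (Φ p) (ν p) (ν p) = 1 := hν.unit
  have hνu : ∀ p, g.val (Φ p) (ν p) (perp T O p (ν p)) = 0 := fun p => (hν.metric_perp hΦ T p).2.1
  have huu : ∀ p, g.val (Φ p) (perp T O p (ν p)) (perp T O p (ν p)) = -1 :=
    fun p => (hν.metric_perp hΦ T p).2.2.1
  simp only [hνν, hνu, huu, fderiv_fun_const, Pi.zero_apply, zero_apply] at c1 c2 c3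
  have l := metric_covDeriv_add hs (hν.smooth.smul hs hch) (hu.smul hs hsh) hy (g := g)
  have m1 := metric_covDeriv_smul hs hν.smooth hch hy (g := g)
  have m2 := metric_covDeriv_smul hs hu hsh hy (g := g)
  rw [l, m1, m2, (hν.metric_perp hΦ T _).2.2.2, dch, dsh]
  set q := (extChartAt (𝓡 2) p₀).symm y
  have hun : g.val (Φ q) (perp T O q (ν q)) (ν q) = 0 := by rw [g.symm]; exact hνu q
  simp only [map_add, map_smul, add_apply, smul_apply, smul_eq_mul, hνν, hνu, huu, hun]
  have hcs := Real.cosh_sq (f q)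
  set K := g.val (Φ q) (perp T O q (ν q)) (covDeriv g Φ ν q (frame p₀ q c))
  set df := fderiv ℝ (fun y => f ((extChartAt (𝓡 2) p₀).symm y)) y c
  set K2 := g.val (Φ q) (ν q)
    (covDeriv g Φ (fun p => perp T O p (ν p)) q (frame p₀ q c)) with hK2
  -- Differentiating the constants `⟨ν, ν⟩ = 1`, `⟨ν^⊥, ν^⊥⟩ = -1` and `⟨ν, ν^⊥⟩ = 0` leaves `K` as
  -- the only connection coefficient, up to sign.
  have k1 : g.val (Φ q) (ν q) (covDeriv g Φ ν q (frame p₀ q c)) = 0 := by linarith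
  have k2 : g.val (Φ q) (perp T O q (ν q))
    (covDeriv g Φ (fun p => perp T O p (ν p)) q (frame p₀ q c)) = 0 := by linarith
  have k3 : K2 = -K := by linarith
  rw [k1, k2, k3]
  -- What remains is `(cosh² - sinh²)(K - df)`; the minus sign before `df` comes from `ν^⊥` being
  -- timelike.
  linear_combination (K - df) * hcs

end NormalBundle

end StraightOut

end

theorem proposition3p1
    {N : Type*} [TopologicalSpace N] [T2Space N] [SecondCountableTopology N]
    [ChartedSpace (StraightOut.Coord 4) N] [IsManifold (𝓡 4) ∞ N]
    {S : Type*} [TopologicalSpace S] [T2Space S] [CompactSpace S]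
    [ChartedSpace (StraightOut.Coord 2) S] [IsManifold (𝓡 2) ∞ S]
    [MeasurableSpace S] [BorelSpace S]
    (g : StraightOut.LorentzMetric N) (T : StraightOut.TimeOrientation g)
    (Φ : S → N) (hΦ : StraightOut.IsSpacelikeEmbedding g Φ)
    (O : StraightOut.OutwardDirection g Φ)
    (ν : StraightOut.FieldAlong Φ) (hν : StraightOut.IsUnitOutwardNormal O ν) :
    (∀ μ : StraightOut.FieldAlong Φ, StraightOut.IsUnitOutwardNormal O μ →
        StraightOut.energy T O ν ≤ StraightOut.energy T O μ) ↔
      ∀ p : S, StraightOut.divergence (StraightOut.induced g Φ)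
        (StraightOut.connectionForm T O ν) p = 0 := by
  -- Compactness gives a countable atlas; this is used in comparing `area` with the chart measures.
  have : SecondCountableTopology S :=
    ChartedSpace.secondCountable_of_sigmaCompact (StraightOut.Coord 2) S
  rw [← StraightOut.forall_integral_normSq_le_iff hΦ.isRiemannian_induced
    (StraightOut.isC1_connectionForm hΦ hν)]
  constructor
  -- Hyperbolic rotations translate between competitors `μ` and functions `f`, one implication for
  -- each direction of the correspondence.
  · intro h f hf
    rw [← StraightOut.connectionForm_rotate hΦ hν hf]
    exact h _ (hν.rotate hΦ T hf)
  · intro h μ hμ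
    obtain ⟨f, hf, rfl⟩ := hν.exists_rotate hΦ T hμ
    have := h f hf
    rwa [← StraightOut.connectionForm_rotate hΦ hν hf] at this
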